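/- Let $\kappa>0$, $T>0$, $V(x)=|x|^2/2$ on $\mathbb R^d$, and let $W\in L^1_{loc}(\mathbb R^d)$ be symmetric, $W(-x)=W(x)$, with weak gradient $\nabla W\in W^{1,\infty}(\mathbb R^d)$ (below $\nabla W$ denotes its continuous representative). Let $\mathcal P_2(\mathbb R^d)$ be the set of Borel probability measures with finite second moment, with the $2$-Wasserstein distance, and let $\rho_0\in\mathcal P_2(\mathbb R^d)$. For a curve $\rho$ of measures put $u(t,x)=-\kappa\big(\nabla V(x)+\int\nabla W(x-y)\,d\rho_t(y)\big)$. A weak solution on $[0,T]$ of the aggregation equation $$\partial_t\rho+\nabla\cdot(\rho u)=0,\qquad \rho u=-\kappa\rho(\nabla V+\nabla W\star\rho),\qquad \rho|_{t=0}=\rho_0,$$ is a curve $\rho\in C([0,T];\mathcal P_2(\mathbb R^d))$ with $\rho|_{t=0}=\rho_0$ that satisfies the equation in the sense of distributions on $(0,T)\times\mathbb R^d$, i.e. $\int_0^T\int(\partial_t\varphi+u\cdot\nabla\varphi)\,d\rho_t\,dt=0$ for all $\varphi\in C_c^\infty((0,T)\times\mathbb R^d)$. Then there exists a unique weak solution $\rho$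 on $[0,T]$. Moreover $\sqrt\rho\,(\partial_t u+u\cdot\nabla u)\in L^2(0,T;L^2(\mathbb R^d))$ in the following sense: there is a Borel function $a:\mathbb R\times\mathbb R^d\to\mathbb R^d$ such that, for a.e. $t\in(0,T)$ and $\rho_t$-a.e. $x$, the vector $a(t,x)$ is the derivative of $u$ at $(t,x)$ in the space-time direction $(1,u(t,x))$ (that is, $a=\partial_t u+u\cdot\nabla u$), and $$\int_0^T\int_{\mathbb R^d}|a(t,x)|^2\,d\rho_t(x)\,dt<\infty .$$ If $\rho_0$ is absolutely continuous with respect to Lebesgue measure, then moreover, for a.e. $t\in(0,T)$ and $\rho_t$-a.e. $x$, $u$ is differentiable at $(t,x)$ and $a=\partial_t u+(u\cdot\nabla)u$ holds with the classical derivatives. -/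

import Mathlib

open MeasureTheory Set Filter Topology
open scoped ENNReal ContDiff

namespace Aggregation

/-- The Euclidean space `ℝ^d`. -/
abbrev Space (d : ℕ) : Type := EuclideanSpace ℝ (Fin d)

/-! ### Weak derivatives and `W^{1,∞}` -/

/-- `g` is the weak `i`-th partial derivative of `f` on `ℝ^d`:
`∫ f ∂_i φ = - ∫ g φ` for every `φ ∈ C_c^∞(ℝ^d)`. -/
def IsWeakPartial {d : ℕ} (i : Fin d) (f g : Space d → ℝ) : Prop :=
  LocallyIntegrable f volume ∧ LocallyIntegrable g volume ∧
    ∀ φ : Space d → ℝ, ContDiff ℝ ∞ φ → HasCompactSupport φ →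
      ∫ x, f x * fderiv ℝ φ x (EuclideanSpace.single i 1) = - ∫ x, g x * φ x

/-- `G` is a weak gradient of `f`. -/
def IsWeakGradient {d : ℕ} (f : Space d → ℝ) (G : Space d → Space d) : Prop :=
  ∀ i, IsWeakPartial i f (fun x => G x i)

/-- The Sobolev space `W^{1,∞}(ℝ^d)`: essentially bounded functions all of whose weak first
derivatives are essentially bounded functions. -/
def MemW1Infty {d : ℕ} (f : Space d → ℝ) : Prop :=
  MemLp f ∞ volume ∧ ∀ i, ∃ g : Space d → ℝ, MemLp g ∞ volume ∧ IsWeakPartial i f g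

/-- `∇W ∈ W^{1,∞}(ℝ^d)`, the gradient being understood in the weak sense. -/
def GradMemW1Infty {d : ℕ} (W : Space d → ℝ) : Prop :=
  LocallyIntegrable W volume ∧
    ∃ G : Space d → Space d, IsWeakGradient W G ∧ ∀ i, MemW1Infty (fun x => G x i)

/-- A weak gradient has at most one continuous representative, so that the choice made in
`contGrad` below does not matter. -/
theorem IsWeakGradient.eq_of_continuous {d : ℕ} {W : Space d → ℝ} {G H : Space d → Space d}
    (hG : IsWeakGradient W G) (hH : IsWeakGradient W H) (cG : Continuous G) (cH : Continuous H) :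
    G = H := by
  have key : ∀ i, (fun x => G x i) = (fun x => H x i) := by
    intro i
    have c1 : Continuous (fun x => G x i) := by fun_prop
    have c2 : Continuous (fun x => H x i) := by fun_prop
    refine (Continuous.ae_eq_iff_eq volume c1 c2).1 ?_
    refine ae_eq_of_integral_contDiff_smul_eq (hG i).2.1 (hH i).2.1 ?_
    intro φ h1 h2
    have e1 := (hG i).2.2 φ h1 h2
    have e2 := (hH i).2.2 φ h1 h2
    have e3 := neg_injective (e1.symm.trans e2)
    simpa [smul_eq_mul, mul_comm] using e3
  funext x
  ext i
  exact congrFun (key i) x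

open Classical in
/-- The continuous representative of the weak gradient `∇W` (it exists as soon as
`∇W ∈ W^{1,∞}(ℝ^d)`, because `W^{1,∞}` functions have Lipschitz representatives). A pointwise
defined gradient is needed in order to convolve it with a possibly singular measure. -/
noncomputable def contGrad {d : ℕ} (W : Space d → ℝ) : Space d → Space d :=
  if h : ∃ G : Space d → Space d, Continuous G ∧ IsWeakGradient W G then h.choose else 0

/-! ### The space `P_2(ℝ^d)` with the 2-Wasserstein distance -/

/-- `μ ∈ P_2(ℝ^d)`: a Borel probability measure with finite second moment. -/
def MemP2 {d : ℕ} (μ : Measure (Space d)) : Prop :=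
  IsProbabilityMeasure μ ∧ ∫⁻ x, ‖x‖ₑ ^ 2 ∂μ < ⊤

/-- The 2-Wasserstein distance
`W_2(μ, ν) = inf_π (∫ |x - y|² dπ(x, y))^{1/2}` over all couplings `π` of `μ` and `ν`. -/
noncomputable def W2 {d : ℕ} (μ ν : Measure (Space d)) : ℝ≥0∞ :=
  ⨅ π : {π : Measure (Space d × Space d) // π.map Prod.fst = μ ∧ π.map Prod.snd = ν},
    (∫⁻ p, ‖p.1 - p.2‖ₑ ^ 2 ∂π.1) ^ (1 / 2 : ℝ)

/-- `ρ ∈ C([0,T]; P_2(ℝ^d))`. The values of `ρ` outside `[0,T]` are irrelevant. -/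
def ContinuousP2 {d : ℕ} (T : ℝ) (ρ : ℝ → Measure (Space d)) : Prop :=
  (∀ t ∈ Icc 0 T, MemP2 (ρ t)) ∧
    ∀ t ∈ Icc 0 T, Tendsto (fun s => W2 (ρ s) (ρ t)) (𝓝[Icc 0 T] t) (𝓝 0)

/-! ### The aggregation equation -/

/-- The confinement potential `V(x) = |x|²/2`. -/
noncomputable def confinement {d : ℕ} (x : Space d) : ℝ := ‖x‖ ^ 2 / 2

/-- The velocity field `u = -κ (∇V + ∇W ⋆ ρ)`. -/
noncomputable def velocity {d : ℕ} (κ : ℝ) (W : Space d → ℝ) (ρ : ℝ → Measure (Space d))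
    (t : ℝ) (x : Space d) : Space d :=
  -(κ • (gradient confinement x + ∫ y, contGrad W (x - y) ∂(ρ t)))

/-- `ρ` satisfies `∂_t ρ + ∇ · (ρ u) = 0` on `(0,T) × ℝ^d` in the sense of distributions. -/
def ContinuityEq {d : ℕ} (T : ℝ) (ρ : ℝ → Measure (Space d)) (u : ℝ → Space d → Space d) :
    Prop :=
  ∀ φ : ℝ × Space d → ℝ, ContDiff ℝ ∞ φ → HasCompactSupport φ →
    tsupport φ ⊆ Ioo 0 T ×ˢ univ →
      ∫ t in Ioo 0 T, ∫ x, (deriv (fun s => φ (s, x)) t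
        + fderiv ℝ (fun y => φ (t, y)) x (u t x)) ∂(ρ t) = 0

/-- `ρ` is a weak solution on `[0,T]`, with initial datum `ρ₀`, of the aggregation equation
`∂_t ρ + ∇ · (ρ u) = 0`, `ρ u = -κ ρ (∇V + ∇W ⋆ ρ)`. -/
structure IsWeakSolution {d : ℕ} (κ T : ℝ) (W : Space d → ℝ) (ρ₀ : Measure (Space d))
    (ρ : ℝ → Measure (Space d)) : Prop where
  continuousP2 : ContinuousP2 T ρ
  continuityEq : ContinuityEq T ρ (velocity κ W ρ)
  initial : ρ 0 = ρ₀

/-- `a` is the acceleration `∂_t u + u · ∇_x u` at `ρ_t(dx) dt`-almost every point, understood as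
the derivative of `(t, x) ↦ u(t, x)` at `(t, x)` in the space-time direction `(1, u(t, x))`.
(For a singular `ρ_t` the field `u` need not have the separate derivatives `∂_t u` and `∇_x u`
at points charged by `ρ_t`; wherever `u` is differentiable this is their usual combination.) -/
def IsAcceleration {d : ℕ} (T : ℝ) (ρ : ℝ → Measure (Space d)) (u : ℝ → Space d → Space d)
    (a : ℝ × Space d → Space d) : Prop :=
  ∀ᵐ t ∂(volume.restrict (Ioo 0 T)), ∀ᵐ x ∂(ρ t),
    HasLineDerivAt ℝ (fun p : ℝ × Space d => u p.1 p.2) (a (t, x)) (t, x) (1, u t x)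

/-- The classical version of the previous notion: at `ρ_t(dx) dt`-almost every point `u` is
differentiable in `(t, x)` and `a = ∂_t u + (u · ∇_x) u`. -/
def IsClassicalAcceleration {d : ℕ} (T : ℝ) (ρ : ℝ → Measure (Space d))
    (u : ℝ → Space d → Space d) (a : ℝ × Space d → Space d) : Prop :=
  ∀ᵐ t ∂(volume.restrict (Ioo 0 T)), ∀ᵐ x ∂(ρ t),
    DifferentiableAt ℝ (fun p : ℝ × Space d => u p.1 p.2) (t, x) ∧
      a (t, x) = deriv (fun s => u s x) t + fderiv ℝ (u t) x (u t x)

/-- `√ρ a ∈ L²(0,T; L²(ℝ^d))`, i.e. `a` is measurable and `∫_0^T ∫ |a|² dρ_t dt < ∞`. -/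
def SqrtRhoMulMemL2 {d : ℕ} (T : ℝ) (ρ : ℝ → Measure (Space d))
    (a : ℝ × Space d → Space d) : Prop :=
  Measurable a ∧ ∫⁻ t in Ioo 0 T, ∫⁻ x, ‖a (t, x)‖ₑ ^ 2 ∂(ρ t) < ⊤

end Aggregation

/-!
The equation is solved along characteristics. Functions in `W^{1,∞}` have bounded Lipschitz
representatives (`MemW1Infty.exists_lipschitz`, by mollification), so the kernel `K = contGrad W`
is bounded and Lipschitz. For a `W₂`-continuous curve `ρ` the velocity
`u = -κ (x + ∫ K(x - y) dρ_t(y))` is therefore Lipschitz in `x` and uniformly continuous in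
`(t, x)` (`uniformContinuous_extVelocity`), and it has a flow `X_t` by bi-Lipschitz maps.

*Representation.* Every weak solution satisfies `ρ_t = (X_t)_# ρ₀` (`eq_map_flow`). For a Lipschitz
`ψ` with compact support, the function `φ(t, x) = ψ(X_t⁻¹(x))` is constant along the flow but only
Lipschitz in space, hence not a test function. Its mollification `φ_ε` in space-time is smooth,
and comparing difference quotients of `φ` along straight lines with the trajectories of `u` gives
`∂_t φ_ε + u · ∇φ_ε → 0` uniformly, because `u` is uniformly continuous
(`IsFlow.abs_transport_sub_le`, `abs_fderiv_normed_convolution_le`). So `∫ φ(t, ·) dρ_t` has zero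
distributional derivative and is constant.

*Existence and uniqueness.* By the representation, weak solutions correspond to solutions of the
mean field equation `X' = -κ (X + ∫ K(X - X(y)) dρ₀(y))`, `X₀ = id`. Divided by `1 + |x|`, this is
an ordinary differential equation with a Lipschitz right-hand side in the Banach space of bounded
continuous maps (`exists_meanField_flow`); the image of `ρ₀` is a weak solution by the chain rule
and Fubini's theorem. Uniqueness is a Grönwall argument (`meanField_flow_unique`).

*Acceleration.* Since `X_t(y)` is Lipschitz in time with constant `O(1 + |y|)` and `ρ₀` has a first
moment, the representation makes `u` Lipschitz in `(t, x)`
(`exists_lipschitzWith_uncurry_extVelocity`). Along each trajectory `t ↦ u(t, X_t(y))` is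
Lipschitz, so differentiable at almost every `t`; by Fubini's theorem, this holds at almost every
`t` for `ρ₀`-almost every `y`. The trajectory is tangent to the space-time direction `(1, u)`, so
the derivative of `u` in that direction exists as well (`differentiableAt_alongVelocity`). It is
`O(1 + |y|)`, which is square integrable against `ρ₀`. If `ρ₀` is absolutely continuous, so is
`ρ_t`, because `X_t⁻¹` is Lipschitz, and Rademacher's theorem in space-time gives classical
differentiability.
-/

namespace Aggregation

/-! ### Trajectories of a Lipschitz field -/

section Trajectories

open scoped NNReal

variable {E : Type*} [NormedAddCommGroup E] [NormedSpace ℝ E]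

/-- `α` solves `α' = v(t, α)` at every time of the closed interval `[0, T]`. The derivative is
two-sided also at the end points, so that `α` is a solution on a neighbourhood of `[0, T]`. -/
def IsTrajectory (T : ℝ) (v : ℝ → E → E) (α : ℝ → E) : Prop :=
  ∀ t ∈ Icc 0 T, HasDerivAt α (v t (α t)) t

theorem IsTrajectory.continuousOn {T : ℝ} {v : ℝ → E → E} {α : ℝ → E} (h : IsTrajectory T v α) :
    ContinuousOn α (Icc 0 T) :=
  fun t ht => (h t ht).continuousAt.continuousWithinAt

/-- A damped field `-κ x + b(t, x)` with `b` bounded has a trajectory through every point, on the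
whole of `[0, T]`: in the variable `z = exp (κ t) x` the field is bounded on bounded time
intervals, and one application of the Picard-Lindelöf theorem suffices. -/
theorem exists_isTrajectory [CompleteSpace E] {κ B : ℝ} {C : ℝ≥0} {b : ℝ → E → E}
    (hb : ∀ t x, ‖b t x‖ ≤ B) (hL : ∀ t, LipschitzWith C (b t)) (hc : ∀ x, Continuous (b · x))
    {T t₀ : ℝ} (ht₀ : t₀ ∈ Icc 0 T) (x₀ : E) :
    ∃ α : ℝ → E, α t₀ = x₀ ∧ IsTrajectory T (fun t x => -(κ • x) + b t x) α := by
  have hT : 0 ≤ T := ht₀.1.trans ht₀.2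
  have hB : 0 ≤ B := (norm_nonneg _).trans (hb 0 0)
  have hjoint : Continuous (Function.uncurry b) :=
    continuous_prod_of_continuous_lipschitzWith' (Function.uncurry b) C hL hc
  set M : ℝ≥0 := ⟨Real.exp (|κ| * (T + 1)), (Real.exp_pos _).le⟩ with hM
  have hM0 : (0 : ℝ) ≤ M := M.2
  have hexp : ∀ t ∈ Icc (-1) (T + 1), ∀ σ : ℝ, |σ| = |κ| → Real.exp (σ * t) ≤ M := by
    intro t ht σ hσ
    refine Real.exp_le_exp.2 ?_
    calc σ * t ≤ |σ * t| := le_abs_self _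
      _ = |κ| * |t| := by rw [abs_mul, hσ]
      _ ≤ |κ| * (T + 1) := by
        gcongr
        exact abs_le.2 ⟨by linarith [ht.1], ht.2⟩
  let f : ℝ → E → E := fun t z => Real.exp (κ * t) • b t (Real.exp (-κ * t) • z)
  have hPL : IsPicardLindelof f (tmin := -1) (tmax := T + 1)
      ⟨t₀, by linarith [ht₀.1], by linarith [ht₀.2]⟩ (Real.exp (κ * t₀) • x₀)
      (M * ⟨B, hB⟩ * ⟨T + 2, by linarith⟩) 0 (M * ⟨B, hB⟩) (M * (C * M)) := by
    refine ⟨fun t ht => ?_, fun z _ => ?_, fun t ht z _ => ?_, ?_⟩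
    · refine LipschitzOnWith.of_dist_le_mul fun z _ z' _ => ?_
      simp only [f]
      rw [dist_smul₀, Real.norm_of_nonneg (Real.exp_pos _).le]
      have h1 := (hL t).dist_le_mul (Real.exp (-κ * t) • z) (Real.exp (-κ * t) • z')
      rw [dist_smul₀, Real.norm_of_nonneg (Real.exp_pos _).le] at h1
      have e1 := hexp t ht κ rfl
      have e2 := hexp t ht (-κ) (abs_neg κ)
      push_cast
      calc Real.exp (κ * t) * dist (b t (Real.exp (-κ * t) • z)) (b t (Real.exp (-κ * t) • z'))
          ≤ M * (C * (M * dist z z')) := by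
            gcongr
            exact h1.trans (by gcongr)
        _ = _ := by ring
    · have : Continuous fun t => Function.uncurry b (t, Real.exp (-κ * t) • z) :=
        hjoint.comp (by fun_prop)
      exact ((by fun_prop : Continuous fun t => Real.exp (κ * t)).smul this).continuousOn
    · simp only [f]
      rw [norm_smul, Real.norm_of_nonneg (Real.exp_pos _).le]
      exact mul_le_mul (hexp t ht κ rfl) (hb _ _) (norm_nonneg _) hM0
    · push_cast
      rw [sub_zero]
      have : max (T + 1 - t₀) (t₀ - -1) ≤ T + 2 :=
        max_le (by linarith [ht₀.1]) (by linarith [ht₀.2])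
      exact mul_le_mul_of_nonneg_left this (mul_nonneg hM0 hB)
  obtain ⟨z, hz0, hz⟩ := hPL.exists_eq_forall_mem_Icc_hasDerivWithinAt₀
  refine ⟨fun t => Real.exp (-κ * t) • z t, ?_, fun t ht => ?_⟩
  · simp only at hz0 ⊢
    rw [hz0, smul_smul, ← Real.exp_add]
    simp
  · have h1 : HasDerivAt z (f t (z t)) t :=
      (hz t ⟨by linarith [ht.1], by linarith [ht.2]⟩).hasDerivAt
        (Icc_mem_nhds (by linarith [ht.1]) (by linarith [ht.2]))
    have h2 : HasDerivAt (fun t => Real.exp (-κ * t)) (Real.exp (-κ * t) * -κ) t := by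
      simpa using ((hasDerivAt_id t).const_mul (-κ)).exp
    refine (h2.smul h1).congr_deriv ?_
    simp only [f]
    rw [smul_smul, ← Real.exp_add, mul_comm (Real.exp (-κ * t)) (-κ), mul_smul, neg_smul]
    simp [add_comm]

variable {T : ℝ} {v : ℝ → E → E} {C : ℝ≥0} {α β : ℝ → E}

/-- Two trajectories of a Lipschitz field control each other forwards and backwards in time. -/
theorem IsTrajectory.dist_le (hv : ∀ t, LipschitzWith C (v t)) (hα : IsTrajectory T v α)
    (hβ : IsTrajectory T v β) {s t : ℝ} (hs : s ∈ Icc 0 T) (ht : t ∈ Icc 0 T) :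
    dist (α t) (β t) ≤ Real.exp (C * T) * dist (α s) (β s) := by
  rcases le_total s t with hst | hst
  · have hsub : Icc s t ⊆ Icc 0 T := Icc_subset_Icc hs.1 ht.2
    have h := dist_le_of_trajectories_ODE hv (hα.continuousOn.mono hsub)
      (fun r hr => (hα r (hsub (Ico_subset_Icc_self hr))).hasDerivWithinAt)
      (hβ.continuousOn.mono hsub)
      (fun r hr => (hβ r (hsub (Ico_subset_Icc_self hr))).hasDerivWithinAt) le_rfl t ⟨hst, le_rfl⟩
    refine h.trans ?_
    rw [mul_comm]
    gcongr
    linarith [hs.1, ht.2]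
  · have hmem : ∀ r ∈ Icc 0 (s - t), s - r ∈ Icc 0 T := fun r hr =>
      ⟨by linarith [hr.2, ht.1], by linarith [hr.1, hs.2]⟩
    have key : ∀ γ : ℝ → E, IsTrajectory T v γ → ∀ r ∈ Icc 0 (s - t),
        HasDerivAt (fun r => γ (s - r)) (-(v (s - r) (γ (s - r)))) r := by
      intro γ hγ r hr
      have := (hγ (s - r) (hmem r hr)).scomp r ((hasDerivAt_id r).const_sub s)
      simpa [Function.comp_def] using this
    have h := dist_le_of_trajectories_ODE (v := fun r x => -(v (s - r) x)) (K := C)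
      (f := fun r => α (s - r)) (g := fun r => β (s - r)) (a := 0) (b := s - t)
      (fun r => (hv (s - r)).neg)
      (fun r hr => (key α hα r hr).continuousAt.continuousWithinAt)
      (fun r hr => (key α hα r (Ico_subset_Icc_self hr)).hasDerivWithinAt)
      (fun r hr => (key β hβ r hr).continuousAt.continuousWithinAt)
      (fun r hr => (key β hβ r (Ico_subset_Icc_self hr)).hasDerivWithinAt) le_rfl (s - t)
      ⟨by linarith, le_rfl⟩
    simp only [sub_sub_cancel, sub_zero] at h
    refine h.trans ?_
    rw [mul_comm]
    gcongr
    linarith [hs.2, ht.1]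

theorem IsTrajectory.eq_of_eq (hv : ∀ t, LipschitzWith C (v t)) (hα : IsTrajectory T v α)
    (hβ : IsTrajectory T v β) {s t : ℝ} (hs : s ∈ Icc 0 T) (ht : t ∈ Icc 0 T) (h : α s = β s) :
    α t = β t := by
  have := hα.dist_le hv hβ hs ht
  rw [h, dist_self, mul_zero] at this
  exact dist_le_zero.1 this

theorem gronwallBound_zero_le {K ε h : ℝ} (hK : 0 ≤ K) (hε : 0 ≤ ε) :
    gronwallBound 0 K ε h ≤ ε * h * Real.exp (K * h) := by
  rcases hK.eq_or_lt with rfl | hK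
  · simp [gronwallBound_K0]
  · simp only [gronwallBound_of_K_ne_0 hK.ne', zero_mul, zero_add]
    have h1 : 1 - K * h ≤ Real.exp (-(K * h)) := by linarith [Real.add_one_le_exp (-(K * h))]
    have h2 : Real.exp (K * h) - 1 ≤ K * h * Real.exp (K * h) := by
      have h3 := mul_le_mul_of_nonneg_right h1 (Real.exp_pos (K * h)).le
      rw [← Real.exp_add, neg_add_cancel, Real.exp_zero] at h3
      linarith
    calc ε / K * (Real.exp (K * h) - 1) ≤ ε / K * (K * h * Real.exp (K * h)) := by gcongr
      _ = ε * h * Real.exp (K * h) := by field_simp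

/-- As long as the field is close to `ξ` at the starting point, a trajectory is close to the
straight line of direction `ξ`. -/
theorem IsTrajectory.norm_sub_smul_le (hv : ∀ t, LipschitzWith C (v t)) (hα : IsTrajectory T v α)
    {t h η : ℝ} (ht : 0 ≤ t) (hh : 0 ≤ h) (hth : t + h ≤ T) {ξ : E}
    (hη : ∀ s ∈ Icc t (t + h), ‖v s (α t) - ξ‖ ≤ η) :
    ‖α (t + h) - α t - h • ξ‖ ≤ (C * h * ‖ξ‖ + η) * h * Real.exp (C * h) := by
  have hη0 : 0 ≤ η := (norm_nonneg _).trans (hη t ⟨le_rfl, by linarith⟩)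
  have hsub : Icc t (t + h) ⊆ Icc 0 T := Icc_subset_Icc ht hth
  have hd : ∀ s ∈ Icc t (t + h),
      HasDerivAt (fun s => α s - α t - (s - t) • ξ) (v s (α s) - ξ) s := by
    intro s hs
    have h1 : HasDerivAt (fun s => (s - t) • ξ) ((1 : ℝ) • ξ) s :=
      ((hasDerivAt_id s).sub_const t).smul_const ξ
    rw [one_smul] at h1
    exact ((hα s (hsub hs)).sub_const _).sub h1
  have := norm_le_gronwallBound_of_norm_deriv_right_le (K := C) (ε := C * h * ‖ξ‖ + η)
    (f := fun s => α s - α t - (s - t) • ξ) (f' := fun s => v s (α s) - ξ) (δ := 0)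
    (a := t) (b := t + h)
    (fun s hs => (hd s hs).continuousAt.continuousWithinAt)
    (fun s hs => (hd s (Ico_subset_Icc_self hs)).hasDerivWithinAt) (by simp)
    (fun s hs => by
      have hs' := Ico_subset_Icc_self hs
      have h1 : ‖v s (α s) - v s (α t)‖ ≤ C * ‖α s - α t‖ := (hv s).norm_sub_le _ _
      have h2 : ‖α s - α t‖ ≤ ‖α s - α t - (s - t) • ξ‖ + h * ‖ξ‖ := by
        calc ‖α s - α t‖ = ‖(α s - α t - (s - t) • ξ) + (s - t) • ξ‖ := by rw [sub_add_cancel]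
          _ ≤ _ := norm_add_le _ _
          _ ≤ _ := by
            rw [norm_smul, Real.norm_of_nonneg (by linarith [hs'.1])]
            gcongr
            linarith [hs'.2]
      calc ‖v s (α s) - ξ‖ = ‖(v s (α s) - v s (α t)) + (v s (α t) - ξ)‖ := by
            rw [sub_add_sub_cancel]
        _ ≤ ‖v s (α s) - v s (α t)‖ + ‖v s (α t) - ξ‖ := norm_add_le _ _
        _ ≤ C * (‖α s - α t - (s - t) • ξ‖ + h * ‖ξ‖) + η :=
          add_le_add (h1.trans (by gcongr)) (hη s hs')
        _ = _ := by ring) (t + h) ⟨by linarith, le_rfl⟩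
  simp only [add_sub_cancel_left] at this
  exact this.trans (gronwallBound_zero_le C.2 (by positivity))

end Trajectories

/-! ### Mollification, separation of measures, and the du Bois-Reymond lemma -/

section Mollification

open scoped Convolution
open ContinuousLinearMap (lsmul)

variable {G : Type*} [NormedAddCommGroup G] [NormedSpace ℝ G] [FiniteDimensional ℝ G]
  [MeasurableSpace G] [BorelSpace G] {μ : Measure G} [μ.IsAddHaarMeasure]

/-- A bound on the difference quotients of `φ` near `z` in the direction `ξ` passes to the
directional derivative of the mollification of `φ`. -/
theorem abs_fderiv_normed_convolution_le (η : ContDiffBump (0 : G)) {φ : G → ℝ}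
    (hφ : Continuous φ) {z ξ : G} {m : ℝ → ℝ} {m₀ : ℝ} (hm : Tendsto m (𝓝[>] 0) (𝓝 m₀))
    (h : ∀ᶠ h in 𝓝[>] (0 : ℝ), ∀ y ∈ Metric.ball z η.rOut, |φ (y + h • ξ) - φ y| ≤ h * m h) :
    |fderiv ℝ (η.normed μ ⋆[lsmul ℝ ℝ, μ] φ) z ξ| ≤ m₀ := by
  have hsm : ContDiff ℝ 1 (η.normed μ ⋆[lsmul ℝ ℝ, μ] φ) :=
    η.hasCompactSupport_normed.contDiff_convolution_left (n := 1) _ η.contDiff_normed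
      hφ.locallyIntegrable
  have hconv : ∀ (f : G → ℝ), Continuous f → ConvolutionExists (η.normed μ) f (lsmul ℝ ℝ) μ :=
    fun f hf => η.hasCompactSupport_normed.convolutionExists_left _
      η.continuous_normed hf.locallyIntegrable
  have hline : HasDerivAt (fun s : ℝ => (η.normed μ ⋆[lsmul ℝ ℝ, μ] φ) (z + s • ξ))
      (fderiv ℝ (η.normed μ ⋆[lsmul ℝ ℝ, μ] φ) z ξ) 0 :=
    (hsm.differentiable one_ne_zero z).hasFDerivAt.hasLineDerivAt ξ
  have hs := (hasDerivAt_iff_tendsto_slope.1 hline).mono_left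
    (nhdsWithin_mono 0 (fun x (hx : x ∈ Ioi (0 : ℝ)) => (ne_of_gt hx : x ≠ 0)))
  refine le_of_tendsto_of_tendsto hs.abs hm ?_
  filter_upwards [h, self_mem_nhdsWithin] with s hs (hs0 : 0 < s)
  have heq : (η.normed μ ⋆[lsmul ℝ ℝ, μ] φ) (z + s • ξ) - (η.normed μ ⋆[lsmul ℝ ℝ, μ] φ) z
      = (η.normed μ ⋆[lsmul ℝ ℝ, μ] (fun y => φ (y + s • ξ) - φ y)) z := by
    have h1 := hconv (fun y => φ (y + s • ξ)) (by fun_prop) z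
    have h2 := hconv φ hφ z
    unfold ConvolutionExistsAt at h1 h2
    simp only [convolution_def, map_sub]
    rw [integral_sub h1 h2]
    congr 1
    refine integral_congr_ae (Eventually.of_forall fun w => ?_)
    simp only
    congr 2
    abel
  have hb : dist ((η.normed μ ⋆[lsmul ℝ ℝ, μ] (fun y => φ (y + s • ξ) - φ y)) z) 0 ≤ s * m s :=
    dist_convolution_le
      (mul_nonneg hs0.le ((mul_nonneg_iff_of_pos_left hs0).1
        ((abs_nonneg _).trans (hs z (Metric.mem_ball_self η.rOut_pos)))))
      η.support_normed_eq.subset η.nonneg_normed η.integral_normed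
      (by fun_prop) (fun y hy => by simpa using hs y hy)
  rw [dist_zero_right, ← heq, Real.norm_eq_abs] at hb
  simp only [slope_def_field, zero_smul, add_zero, sub_zero]
  rw [abs_div, abs_of_pos hs0, div_le_iff₀ hs0, mul_comm]
  exact hb

/-- Finite measures are determined by the integrals of Lipschitz functions with compact
support. -/
theorem eq_of_forall_integral_lipschitz_eq {μ ν : Measure G}
    [IsFiniteMeasure μ] [IsFiniteMeasure ν]
    (h : ∀ ψ : G → ℝ, (∃ C, LipschitzWith C ψ) → HasCompactSupport ψ →
      ∫ x, ψ x ∂μ = ∫ x, ψ x ∂ν) : μ = ν := by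
  have : ProperSpace G := FiniteDimensional.proper_rclike ℝ G
  refine Measure.ext_of_integral_eq_on_compactlySupported fun f => ?_
  obtain ⟨K, hK⟩ := f.hasCompactSupport.exists_bound_of_continuous f.continuous
  let η : ℕ → ContDiffBump (0 : G) := fun n =>
    ⟨1 / (2 * (n + 1)), 1 / (n + 1), by positivity, by
      apply one_div_lt_one_div_of_lt <;> linarith [n.cast_nonneg (α := ℝ)]⟩
  let g : ℕ → G → ℝ := fun n => (η n).normed Measure.addHaar ⋆[lsmul ℝ ℝ, Measure.addHaar] f
  have hη : Tendsto (fun n => (η n).rOut) atTop (𝓝 0) := tendsto_one_div_add_atTop_nhds_zero_nat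
  have hgs : ∀ n, ContDiff ℝ 1 (g n) := fun n =>
    (η n).hasCompactSupport_normed.contDiff_convolution_left (n := 1) _ (η n).contDiff_normed
      f.continuous.locallyIntegrable
  have hgc : ∀ n, HasCompactSupport (g n) := fun n =>
    (η n).hasCompactSupport_normed.convolution _ f.hasCompactSupport
  have hgb : ∀ n x, ‖g n x‖ ≤ K := fun n x => by
    have : dist (g n x) 0 ≤ K := dist_convolution_le ((norm_nonneg _).trans (hK 0))
      (η n).support_normed_eq.subset (η n).nonneg_normed (η n).integral_normed
      f.continuous.aestronglyMeasurable (fun y _ => by simpa using hK y)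
    simpa using this
  have hgt : ∀ x, Tendsto (fun n => g n x) atTop (𝓝 (f x)) := fun x =>
    ContDiffBump.convolution_tendsto_right_of_continuous hη f.continuous x
  have lim : ∀ (m : Measure G) [IsFiniteMeasure m],
      Tendsto (fun n => ∫ x, g n x ∂m) atTop (𝓝 (∫ x, f x ∂m)) := fun m _ =>
    tendsto_integral_of_dominated_convergence (fun _ => K)
      (fun n => (hgs n).continuous.aestronglyMeasurable) (integrable_const K)
      (fun n => Eventually.of_forall (hgb n)) (Eventually.of_forall hgt)
  have e : ∀ n, ∫ x, g n x ∂μ = ∫ x, g n x ∂ν := fun n =>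
    h (g n) ((hgs n).lipschitzWith_of_hasCompactSupport (hgc n) one_ne_zero) (hgc n)
  have lμ := lim μ
  simp only [e] at lμ
  exact tendsto_nhds_unique lμ (lim ν)

/-- The du Bois-Reymond lemma: a continuous function on `[0, T]` with vanishing distributional
derivative is constant. -/
theorem eq_of_forall_integral_deriv_mul_eq_zero {T : ℝ} {g : ℝ → ℝ} (hg : ContinuousOn g (Icc 0 T))
    (h : ∀ χ : ℝ → ℝ, ContDiff ℝ ∞ χ → HasCompactSupport χ → tsupport χ ⊆ Ioo 0 T →
      ∫ t in Ioo 0 T, deriv χ t * g t = 0) :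
    ∀ t ∈ Icc 0 T, g t = g 0 := by
  have inner : ∀ s ∈ Ioo 0 T, ∀ t ∈ Ioo 0 T, g s = g t := by
    intro s hs t ht
    have hT : 0 ≤ T := (hs.1.trans hs.2).le
    set G : ℝ → ℝ := IccExtend hT (domRestrict (Icc 0 T) g) with hG
    have hGc : Continuous G := (continuousOn_iff_continuous_domRestrict.1 hg).Icc_extend'
    have hGg : ∀ r ∈ Icc 0 T, G r = g r := fun r hr => by
      rw [hG, IccExtend_of_mem hT _ hr, domRestrict_apply]
    obtain ⟨δ, hδ, hδs, hδt⟩ : ∃ δ > 0, (0 < s - δ ∧ s + δ < T) ∧ (0 < t - δ ∧ t + δ < T) := by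
      refine ⟨min (min (s / 2) ((T - s) / 2)) (min (t / 2) ((T - t) / 2)), ?_, ?_⟩
      · have := hs.1; have := hs.2; have := ht.1; have := ht.2
        simp only [gt_iff_lt, lt_min_iff]
        refine ⟨⟨?_, ?_⟩, ?_, ?_⟩ <;> linarith
      · have h1 := min_le_left (min (s / 2) ((T - s) / 2)) (min (t / 2) ((T - t) / 2))
        have h2 := min_le_right (min (s / 2) ((T - s) / 2)) (min (t / 2) ((T - t) / 2))
        have h3 := min_le_left (s / 2) ((T - s) / 2)
        have h4 := min_le_right (s / 2) ((T - s) / 2)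
        have h5 := min_le_left (t / 2) ((T - t) / 2)
        have h6 := min_le_right (t / 2) ((T - t) / 2)
        have := hs.1; have := hs.2; have := ht.1; have := ht.2
        refine ⟨⟨?_, ?_⟩, ?_, ?_⟩ <;> linarith
    have key : ∀ β : ContDiffBump (0 : ℝ), β.rOut ≤ δ →
        (β.normed volume ⋆[lsmul ℝ ℝ, volume] G) s = (β.normed volume ⋆[lsmul ℝ ℝ, volume] G) t := by
      intro β hβ
      let p : ℝ → ℝ := fun τ => β.normed volume (s - τ) - β.normed volume (t - τ)
      have hp : ContDiff ℝ ∞ p := by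
        have := β.contDiff_normed (μ := (volume : Measure ℝ)) (n := ⊤)
        exact (this.comp (contDiff_const.sub contDiff_id)).sub
          (this.comp (contDiff_const.sub contDiff_id))
      have hβ0 : ∀ r τ : ℝ, β.rOut ≤ |r - τ| → β.normed volume (r - τ) = 0 := by
        intro r τ hr
        rw [← Function.notMem_support, β.support_normed_eq, Metric.mem_ball, dist_zero_right,
          Real.norm_eq_abs, not_lt]
        exact hr
      have hp0 : ∀ τ, τ ∉ Ioo (min s t - δ) (max s t + δ) → p τ = 0 := by
        intro τ hτ
        have h1 : ∀ r ∈ Icc (min s t) (max s t), β.rOut ≤ |r - τ| := by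
          intro r hr
          by_contra! hlt
          rw [abs_lt] at hlt
          exact hτ ⟨by linarith [hr.1], by linarith [hr.2]⟩
        simp only [p]
        rw [hβ0 s τ (h1 s ⟨min_le_left _ _, le_max_left _ _⟩),
          hβ0 t τ (h1 t ⟨min_le_right _ _, le_max_right _ _⟩), sub_zero]
      have hpc : HasCompactSupport p := HasCompactSupport.intro isCompact_Icc
        fun τ hτ => hp0 τ fun h => hτ (Ioo_subset_Icc_self h)
      have hpi : Integrable p := hp.continuous.integrable_of_hasCompactSupport hpc
      have hpint : ∫ τ, p τ = 0 := by
        have i : ∀ r : ℝ, Integrable fun τ => β.normed volume (r - τ) := fun r =>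
          (β.integrable_normed (μ := volume)).comp_sub_left r
        have e : ∀ r : ℝ, ∫ τ, β.normed volume (r - τ) = 1 := fun r => by
          rw [integral_sub_left_eq_self (fun x => β.normed volume x) volume r, β.integral_normed]
        simp only [p]
        rw [integral_sub (i s) (i t), e, e, sub_self]
      let χ : ℝ → ℝ := fun r => ∫ τ in Iic r, p τ
      have hχd : ∀ r, HasDerivAt χ (p r) r := by
        intro r
        have h1 : HasDerivAt (fun u => ∫ τ in (0 : ℝ)..u, p τ) (p r) r :=
          intervalIntegral.integral_hasDerivAt_right (hp.continuous.intervalIntegrable _ _)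
            hp.continuous.stronglyMeasurable.stronglyMeasurableAtFilter hp.continuous.continuousAt
        have h2 : χ = fun u => (∫ τ in Iic 0, p τ) + ∫ τ in (0 : ℝ)..u, p τ := by
          funext u
          rw [← intervalIntegral.integral_Iic_sub_Iic hpi.integrableOn hpi.integrableOn]
          simp [χ]
        rw [h2]
        exact h1.const_add _
      have hderiv : deriv χ = p := funext fun r => (hχd r).deriv
      have hχs : ContDiff ℝ ∞ χ := by
        rw [contDiff_infty_iff_deriv, hderiv]
        exact ⟨fun r => (hχd r).differentiableAt, hp⟩
      have hχ0 : ∀ r, r ∉ Icc (min s t - δ) (max s t + δ) → χ r = 0 := by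
        intro r hr
        rw [mem_Icc, not_and_or, not_le, not_le] at hr
        rcases hr with hr | hr
        · refine setIntegral_eq_zero_of_forall_eq_zero fun τ (hτ : τ ≤ r) => hp0 τ fun h => ?_
          linarith [h.1]
        · have : ∫ τ in Iic r, p τ = ∫ τ, p τ := by
            refine setIntegral_eq_integral_of_forall_compl_eq_zero fun τ hτ => hp0 τ fun h => ?_
            rw [mem_Iic, not_le] at hτ
            linarith [h.2]
          simp only [χ]
          rw [this, hpint]
      have hsub : Icc (min s t - δ) (max s t + δ) ⊆ Ioo 0 T := by
        intro r hr
        rcases le_total s t with hst | hst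
        · rw [min_eq_left hst, max_eq_right hst] at hr
          exact ⟨by linarith [hr.1], by linarith [hr.2]⟩
        · rw [min_eq_right hst, max_eq_left hst] at hr
          exact ⟨by linarith [hr.1], by linarith [hr.2]⟩
      have hts : tsupport χ ⊆ Icc (min s t - δ) (max s t + δ) :=
        closure_minimal (fun r hr => by_contra fun hn => hr (hχ0 r hn)) isClosed_Icc
      have h0 := h χ hχs (HasCompactSupport.intro isCompact_Icc hχ0) (hts.trans hsub)
      rw [hderiv] at h0
      have h1 : ∫ τ in Ioo 0 T, p τ * g τ = ∫ τ, p τ * G τ := by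
        rw [setIntegral_congr_fun (g := fun τ => p τ * G τ) measurableSet_Ioo
          (fun τ hτ => by simp only; rw [hGg τ (Ioo_subset_Icc_self hτ)])]
        refine setIntegral_eq_integral_of_forall_compl_eq_zero fun τ hτ => ?_
        rw [hp0 τ (fun h => hτ (hsub (Ioo_subset_Icc_self h))), zero_mul]
      have i : ∀ r : ℝ, Integrable fun τ => β.normed volume (r - τ) * G τ := fun r => by
        refine Continuous.integrable_of_hasCompactSupport ?_ ?_
        · exact ((β.continuous_normed (μ := volume)).comp (by fun_prop)).mul hGc
        · refine HasCompactSupport.mul_right ?_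
          exact HasCompactSupport.intro (K := Metric.closedBall r β.rOut)
            (isCompact_closedBall _ _) fun τ hτ => hβ0 r τ (by
              rw [Metric.mem_closedBall, Real.dist_eq, not_le, abs_sub_comm] at hτ
              exact hτ.le)
      rw [h1] at h0
      simp only [p, sub_mul] at h0
      rw [integral_sub (i s) (i t), sub_eq_zero] at h0
      simpa only [convolution_eq_swap, ContinuousLinearMap.lsmul_apply, smul_eq_mul] using h0
    let β : ℕ → ContDiffBump (0 : ℝ) := fun n =>
      ⟨1 / (2 * (n + 1)), 1 / (n + 1), by positivity, by
        apply one_div_lt_one_div_of_lt <;> linarith [n.cast_nonneg (α := ℝ)]⟩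
    have hβ : Tendsto (fun n => (β n).rOut) atTop (𝓝 0) := tendsto_one_div_add_atTop_nhds_zero_nat
    have lim : ∀ r, Tendsto (fun n => ((β n).normed volume ⋆[lsmul ℝ ℝ, volume] G) r) atTop
        (𝓝 (G r)) := fun r => ContDiffBump.convolution_tendsto_right_of_continuous hβ hGc r
    have ev : ∀ᶠ n in atTop, (β n).rOut ≤ δ :=
      (hβ.eventually (eventually_lt_nhds hδ)).mono fun n hn => hn.le
    have := tendsto_nhds_unique_of_eventuallyEq (lim s) (lim t) (ev.mono fun n hn => key (β n) hn)
    rwa [hGg s (Ioo_subset_Icc_self hs), hGg t (Ioo_subset_Icc_self ht)] at this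
  intro t ht
  rcases (ht.1.trans ht.2).eq_or_lt with h0 | hT
  · rw [le_antisymm (ht.2.trans h0.symm.le) ht.1]
  · have hmid : T / 2 ∈ Ioo 0 T := ⟨by linarith, by linarith⟩
    have hcl : closure (Ioo 0 T) = Icc 0 T := closure_Ioo hT.ne
    have hconst : ∀ r ∈ Icc 0 T, g r = g (T / 2) := by
      have hEq : EqOn g (fun _ => g (T / 2)) (Ioo 0 T) := fun r hr => inner r hr _ hmid
      have := hEq.of_subset_closure hg continuousOn_const Ioo_subset_Icc_self hcl.ge
      exact this
    rw [hconst t ht, hconst 0 ⟨le_rfl, hT.le⟩]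

end Mollification

/-! ### Flows and the Lagrangian representation of solutions of the continuity equation -/

section Flow

open scoped NNReal

variable {d : ℕ}

/-- `Γ s x` is a trajectory of `v` on `[0, T]` that passes through `x` at time `s`. -/
structure IsFlow (T : ℝ) (v : ℝ → Space d → Space d) (Γ : ℝ → Space d → ℝ → Space d) : Prop where
  apply_self : ∀ s ∈ Icc 0 T, ∀ x, Γ s x s = x
  isTrajectory : ∀ s ∈ Icc 0 T, ∀ x, IsTrajectory T v (Γ s x)

variable {T : ℝ} {v : ℝ → Space d → Space d} {C : ℝ≥0} {Γ : ℝ → Space d → ℝ → Space d}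

namespace IsFlow

theorem dist_apply_le (hΓ : IsFlow T v Γ) (hv : ∀ t, LipschitzWith C (v t)) {s t : ℝ}
    (hs : s ∈ Icc 0 T) (ht : t ∈ Icc 0 T) (x y : Space d) :
    dist (Γ s x t) (Γ s y t) ≤ Real.exp (C * T) * dist x y := by
  have := (hΓ.isTrajectory s hs x).dist_le hv (hΓ.isTrajectory s hs y) hs ht
  rwa [hΓ.apply_self s hs, hΓ.apply_self s hs] at this

theorem lipschitzWith_apply (hΓ : IsFlow T v Γ) (hv : ∀ t, LipschitzWith C (v t)) {s t : ℝ}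
    (hs : s ∈ Icc 0 T) (ht : t ∈ Icc 0 T) :
    LipschitzWith ⟨Real.exp (C * T), (Real.exp_pos _).le⟩ (fun x => Γ s x t) :=
  LipschitzWith.of_dist_le_mul fun x y => hΓ.dist_apply_le hv hs ht x y

/-- The trajectory through a point of another trajectory is that trajectory. -/
theorem apply_apply (hΓ : IsFlow T v Γ) (hv : ∀ t, LipschitzWith C (v t)) {r s t : ℝ}
    (hr : r ∈ Icc 0 T) (hs : s ∈ Icc 0 T) (ht : t ∈ Icc 0 T) (x : Space d) :
    Γ s (Γ r x s) t = Γ r x t :=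
  (hΓ.isTrajectory s hs _).eq_of_eq hv (hΓ.isTrajectory r hr x) hs ht (hΓ.apply_self s hs _)

theorem apply_apply_self (hΓ : IsFlow T v Γ) (hv : ∀ t, LipschitzWith C (v t)) {r s : ℝ}
    (hr : r ∈ Icc 0 T) (hs : s ∈ Icc 0 T) (x : Space d) :
    Γ s (Γ r x s) r = x := by
  rw [hΓ.apply_apply hv hr hs hr, hΓ.apply_self r hr]

theorem continuousOn_forward (hΓ : IsFlow T v Γ) (hv : ∀ t, LipschitzWith C (v t)) (hT : 0 ≤ T) :
    ContinuousOn (fun p : ℝ × Space d => Γ 0 p.2 p.1) (Icc 0 T ×ˢ univ) := by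
  have h0 : (0 : ℝ) ∈ Icc 0 T := ⟨le_rfl, hT⟩
  exact continuousOn_prod_of_continuousOn_lipschitzOnWith' _ _
    (fun t ht => (hΓ.lipschitzWith_apply hv h0 ht).lipschitzOnWith)
    (fun x _ => (hΓ.isTrajectory 0 h0 x).continuousOn)

theorem continuousOn_backward (hΓ : IsFlow T v Γ) (hv : ∀ t, LipschitzWith C (v t)) (hT : 0 ≤ T) :
    ContinuousOn (fun p : ℝ × Space d => Γ p.1 p.2 0) (Icc 0 T ×ˢ univ) := by
  have h0 : (0 : ℝ) ∈ Icc 0 T := ⟨le_rfl, hT⟩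
  rintro ⟨t, x⟩ ⟨ht, -⟩
  have ht : t ∈ Icc 0 T := ht
  rw [ContinuousWithinAt, tendsto_iff_dist_tendsto_zero]
  have hlim : Tendsto (fun p : ℝ × Space d => Real.exp (C * T) * dist p.2 (Γ t x p.1))
      (𝓝[Icc 0 T ×ˢ univ] (t, x)) (𝓝 0) := by
    have hc : ContinuousAt (fun p : ℝ × Space d => Real.exp (C * T) * dist p.2 (Γ t x p.1))
        (t, x) := by
      refine continuousAt_const.mul (continuousAt_snd.dist ?_)
      exact ContinuousAt.comp (f := Prod.fst) (g := Γ t x) (x := (t, x))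
        (hΓ.isTrajectory t ht x t ht).continuousAt continuousAt_fst
    have := hc.tendsto
    simp only [hΓ.apply_self t ht, dist_self, mul_zero] at this
    exact this.mono_left nhdsWithin_le_nhds
  refine squeeze_zero' (Eventually.of_forall fun _ => dist_nonneg) ?_ hlim
  filter_upwards [self_mem_nhdsWithin] with p hp
  have := (hΓ.isTrajectory p.1 hp.1 p.2).dist_le hv (hΓ.isTrajectory t ht x) hp.1 h0
  rwa [hΓ.apply_self p.1 hp.1] at this

/-- A function transported by the flow is almost constant along short straight lines which are
almost tangent to the field. -/
theorem abs_transport_sub_le (hΓ : IsFlow T v Γ) (hv : ∀ t, LipschitzWith C (v t))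
    {ψ : Space d → ℝ} {Λ : ℝ≥0} (hψ : LipschitzWith Λ ψ) {t h η : ℝ} (ht : 0 ≤ t) (hh : 0 ≤ h)
    (hth : t + h ≤ T) {x ξ : Space d} (hη : ∀ s ∈ Icc t (t + h), ‖v s x - ξ‖ ≤ η) :
    |ψ (Γ (t + h) (x + h • ξ) 0) - ψ (Γ t x 0)|
      ≤ h * (Λ * Real.exp (C * T) * ((C * h * ‖ξ‖ + η) * Real.exp (C * h))) := by
  have h0 : (0 : ℝ) ∈ Icc 0 T := ⟨le_rfl, by linarith⟩
  have ht' : t ∈ Icc 0 T := ⟨ht, by linarith⟩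
  have hth' : t + h ∈ Icc 0 T := ⟨by linarith, hth⟩
  have h1 : Γ t x 0 = Γ (t + h) (Γ t x (t + h)) 0 := (hΓ.apply_apply hv ht' hth' h0 x).symm
  have h2 := (hΓ.isTrajectory t ht' x).norm_sub_smul_le hv ht hh hth (ξ := ξ) (η := η)
    (by rwa [hΓ.apply_self t ht'])
  rw [hΓ.apply_self t ht'] at h2
  have h3 := hψ.dist_le_mul (Γ (t + h) (x + h • ξ) 0) (Γ (t + h) (Γ t x (t + h)) 0)
  rw [Real.dist_eq, ← h1] at h3
  have h4 := hΓ.dist_apply_le hv hth' h0 (x + h • ξ) (Γ t x (t + h))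
  rw [← h1] at h4
  have h5 : dist (x + h • ξ) (Γ t x (t + h)) = ‖Γ t x (t + h) - x - h • ξ‖ := by
    rw [dist_comm, dist_eq_norm, sub_add_eq_sub_sub]
  calc _ ≤ Λ * dist (Γ (t + h) (x + h • ξ) 0) (Γ t x 0) := h3
    _ ≤ Λ * (Real.exp (C * T) * ((C * h * ‖ξ‖ + η) * h * Real.exp (C * h))) := by
      gcongr
      exact h4.trans (by rw [h5]; gcongr)
    _ = _ := by ring

end IsFlow

/-- The time derivative plus the advection term is the derivative in the direction `(1, w)`. -/
theorem deriv_add_fderiv_eq {F : Type*} [NormedAddCommGroup F] [NormedSpace ℝ F]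
    {φ : ℝ × Space d → F} {t : ℝ} {x : Space d} (hφ : DifferentiableAt ℝ φ (t, x)) (w : Space d) :
    deriv (fun s => φ (s, x)) t + fderiv ℝ (fun y => φ (t, y)) x w = fderiv ℝ φ (t, x) (1, w) := by
  have h1 : HasDerivAt (fun s => φ (s, x)) (fderiv ℝ φ (t, x) (1, 0)) t :=
    hφ.hasFDerivAt.comp_hasDerivAt (f := fun s : ℝ => (s, x)) t
      ((hasDerivAt_id t).prodMk (hasDerivAt_const t x))
  have h2 : HasFDerivAt (fun y => φ (t, y))
      ((fderiv ℝ φ (t, x)).comp (ContinuousLinearMap.inr ℝ ℝ (Space d))) x :=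
    hφ.hasFDerivAt.comp x (hasFDerivAt_prodMk_right t x)
  rw [h1.deriv, h2.fderiv, ContinuousLinearMap.comp_apply, ContinuousLinearMap.inr_apply,
    ← map_add]
  simp

/-- Narrow continuity on `[0, T]` of a curve of measures, tested against bounded uniformly
continuous functions of time and space. -/
def NarrowlyContinuous (T : ℝ) (ρ : ℝ → Measure (Space d)) : Prop :=
  ∀ F : ℝ × Space d → ℝ, UniformContinuous F → (∃ M, ∀ p, ‖F p‖ ≤ M) →
    ContinuousOn (fun t => ∫ x, F (t, x) ∂(ρ t)) (Icc 0 T)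

end Flow

section Representation

open scoped NNReal Convolution
open ContinuousLinearMap (lsmul)

variable {d : ℕ} {T : ℝ} {v : ℝ → Space d → Space d} {C : ℝ≥0} {Γ : ℝ → Space d → ℝ → Space d}

/-- The function equal to `ψ` at time `0` and constant along the flow. Times outside `[0, T]` are
projected to `[0, T]`. -/
noncomputable def transported (T : ℝ) (hT : 0 ≤ T) (Γ : ℝ → Space d → ℝ → Space d)
    (ψ : Space d → ℝ) (p : ℝ × Space d) : ℝ :=
  ψ (Γ (projIcc 0 T hT p.1) p.2 0)

theorem transported_apply_of_mem (hT : 0 ≤ T) (ψ : Space d → ℝ) {t : ℝ} (ht : t ∈ Icc 0 T)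
    (x : Space d) : transported T hT Γ ψ (t, x) = ψ (Γ t x 0) := by
  simp [transported, projIcc_of_mem hT ht]

theorem continuous_transported (hT : 0 ≤ T) (hΓ : IsFlow T v Γ) (hv : ∀ t, LipschitzWith C (v t))
    {ψ : Space d → ℝ} (hψ : Continuous ψ) : Continuous (transported T hT Γ ψ) := by
  refine hψ.comp ?_
  exact (hΓ.continuousOn_backward hv hT).comp_continuous
    (f := fun p : ℝ × Space d => ((projIcc 0 T hT p.1 : ℝ), p.2))
    ((continuous_subtype_val.comp (continuous_projIcc.comp continuous_fst)).prodMk continuous_snd)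
    (fun p => ⟨(projIcc 0 T hT p.1).2, mem_univ _⟩)

/-- If `ψ` has compact support, the transported function vanishes far from the origin, uniformly
in time. -/
theorem exists_transported_eq_zero (hT : 0 ≤ T) (hΓ : IsFlow T v Γ)
    (hv : ∀ t, LipschitzWith C (v t)) {ψ : Space d → ℝ} (hψ : HasCompactSupport ψ) :
    ∃ R, ∀ p : ℝ × Space d, R < ‖p.2‖ → transported T hT Γ ψ p = 0 := by
  have h0 : (0 : ℝ) ∈ Icc 0 T := ⟨le_rfl, hT⟩
  obtain ⟨r, hr⟩ := hψ.isBounded.exists_norm_le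
  obtain ⟨q, hq⟩ := isCompact_Icc.exists_bound_of_continuousOn (hΓ.isTrajectory 0 h0 0).continuousOn
  refine ⟨Real.exp (C * T) * r + q, fun p hp => by_contra fun hne => ?_⟩
  let t : ℝ := (projIcc 0 T hT p.1 : Icc (0 : ℝ) T)
  have htm : t ∈ Icc 0 T := (projIcc 0 T hT p.1).2
  have h1 : ‖Γ t p.2 0‖ ≤ r := hr _ (subset_tsupport ψ hne)
  have h2 := (hΓ.isTrajectory t htm p.2).dist_le hv (hΓ.isTrajectory 0 h0 0) h0 htm
  rw [hΓ.apply_self t htm, hΓ.apply_self 0 h0, dist_zero_right, dist_eq_norm] at h2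
  have h3 : ‖p.2‖ ≤ ‖p.2 - Γ 0 0 t‖ + ‖Γ 0 0 t‖ := by
    simpa using norm_add_le (p.2 - Γ 0 0 t) (Γ 0 0 t)
  have h4 := hq t htm
  have h5 : Real.exp (C * T) * ‖Γ t p.2 0‖ ≤ Real.exp (C * T) * r := by gcongr
  linarith

theorem uniformContinuous_transported (hT : 0 ≤ T) (hΓ : IsFlow T v Γ)
    (hv : ∀ t, LipschitzWith C (v t)) {ψ : Space d → ℝ} (hψ : Continuous ψ)
    (hψc : HasCompactSupport ψ) : UniformContinuous (transported T hT Γ ψ) := by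
  -- `[0, T] × ℝ^d`, on which the transported function has compact support
  let f : Icc (0 : ℝ) T × Space d → ℝ := fun p => ψ (Γ p.1 p.2 0)
  have hf : Continuous f := hψ.comp ((hΓ.continuousOn_backward hv hT).comp_continuous
    (f := fun p : Icc (0 : ℝ) T × Space d => ((p.1 : ℝ), p.2)) (by fun_prop)
    (fun p => ⟨p.1.2, mem_univ _⟩))
  obtain ⟨R, hR⟩ := exists_transported_eq_zero hT hΓ hv hψc
  have hfc : HasCompactSupport f := by
    refine HasCompactSupport.intro (K := univ ×ˢ Metric.closedBall 0 R)
      (isCompact_univ.prod (isCompact_closedBall _ _)) fun p hp => ?_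
    have : R < ‖p.2‖ := by simpa using hp
    have := hR (p.1, p.2) this
    rwa [transported_apply_of_mem hT ψ p.1.2] at this
  have hproj : UniformContinuous (fun p : ℝ × Space d => (projIcc 0 T hT p.1, p.2)) :=
    ((LipschitzWith.projIcc hT).uniformContinuous.comp uniformContinuous_fst).prodMk
      uniformContinuous_snd
  exact (hfc.uniformContinuous_of_continuous hf).comp hproj

variable {ρ : ℝ → Measure (Space d)}

/-- Against a function transported by the flow, a solution of the continuity equation has a
vanishing distributional time derivative. The transported function is only Lipschitz in space; it
becomes a test function after mollification in space and time, and the mollified function is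
almost transported because the field is uniformly continuous. -/
theorem integral_deriv_mul_integral_transported_eq_zero (hT : 0 ≤ T) (hΓ : IsFlow T v Γ)
    (hv : ∀ t, LipschitzWith C (v t)) (hvu : UniformContinuous (Function.uncurry v))
    (hρ : ∀ t ∈ Icc 0 T, IsProbabilityMeasure (ρ t)) (hρc : NarrowlyContinuous T ρ)
    (heq : ContinuityEq T ρ v) {ψ : Space d → ℝ} {Λ : ℝ≥0} (hψ : LipschitzWith Λ ψ)
    (hψc : HasCompactSupport ψ) {χ : ℝ → ℝ} (hχ : ContDiff ℝ ∞ χ) (hχc : HasCompactSupport χ)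
    (hχT : tsupport χ ⊆ Ioo 0 T) :
    ∫ t in Ioo 0 T, deriv χ t * ∫ x, transported T hT Γ ψ (t, x) ∂(ρ t) = 0 := by
  set φ := transported T hT Γ ψ with hφdef
  have hφ : Continuous φ := continuous_transported hT hΓ hv hψ.continuous
  have hφu : UniformContinuous φ := uniformContinuous_transported hT hΓ hv hψ.continuous hψc
  obtain ⟨Mψ, hMψ⟩ := hψc.exists_bound_of_continuous hψ.continuous
  have hφb : ∀ p, ‖φ p‖ ≤ Mψ := fun p => hMψ _
  obtain ⟨R, hR⟩ := exists_transported_eq_zero hT hΓ hv hψc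
  obtain ⟨A, hA⟩ := hχc.exists_bound_of_continuous hχ.continuous
  have hχ' : Continuous (deriv χ) := hχ.continuous_deriv (by simp)
  obtain ⟨A', hA'⟩ := hχc.deriv.exists_bound_of_continuous hχ'
  have hA0 : 0 ≤ A := (norm_nonneg _).trans (hA 0)
  have hA'0 : 0 ≤ A' := (norm_nonneg _).trans (hA' 0)
  set g : ℝ → ℝ := fun t => ∫ x, φ (t, x) ∂(ρ t) with hg
  have hgc : ContinuousOn g (Icc 0 T) := hρc φ hφu ⟨Mψ, hφb⟩
  obtain ⟨ε₀, hε₀, hε₀T⟩ := hχc.isCompact.exists_cthickening_subset_open isOpen_Ioo hχT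
  have hthick : ∀ t ∈ tsupport χ, ∀ s, |s - t| ≤ ε₀ → s ∈ Ioo 0 T := fun t ht s hs =>
    hε₀T (Metric.mem_cthickening_of_dist_le s t ε₀ _ ht (by rwa [Real.dist_eq]))
  let μ : Measure (ℝ × Space d) := (volume : Measure ℝ).prod (volume : Measure (Space d))
  have : μ.IsAddHaarMeasure := by unfold μ; infer_instance
  -- the error made by mollifying is at most a multiple of `γ`
  have main : ∀ γ > 0, |∫ t in Ioo 0 T, deriv χ t * g t|
      ≤ (A' + A * (Λ * Real.exp (C * T))) * γ * T := by
    intro γ hγ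
    obtain ⟨δ₁, hδ₁, hvδ⟩ := Metric.uniformContinuous_iff.1 hvu γ hγ
    obtain ⟨δ₂, hδ₂, hφδ⟩ := Metric.uniformContinuous_iff.1 hφu γ hγ
    obtain ⟨ε, hε, hε1, hε2, hε3, hε4⟩ :
        ∃ ε > 0, 2 * ε ≤ δ₁ ∧ ε ≤ δ₂ ∧ 2 * ε ≤ ε₀ ∧ ε ≤ 1 := by
      refine ⟨min (min (δ₁ / 2) δ₂) (min (ε₀ / 2) 1), by positivity, ?_, ?_, ?_, ?_⟩
      · linarith [min_le_left (min (δ₁ / 2) δ₂) (min (ε₀ / 2) 1), min_le_left (δ₁ / 2) δ₂]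
      · linarith [min_le_left (min (δ₁ / 2) δ₂) (min (ε₀ / 2) 1), min_le_right (δ₁ / 2) δ₂]
      · linarith [min_le_right (min (δ₁ / 2) δ₂) (min (ε₀ / 2) 1), min_le_left (ε₀ / 2) 1]
      · linarith [min_le_right (min (δ₁ / 2) δ₂) (min (ε₀ / 2) 1), min_le_right (ε₀ / 2) 1]
    let η : ContDiffBump (0 : ℝ × Space d) := ⟨ε / 2, ε, by positivity, by linarith⟩
    set φε : ℝ × Space d → ℝ := η.normed μ ⋆[lsmul ℝ ℝ, μ] φ with hφε
    have hφεs : ContDiff ℝ ∞ φε :=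
      η.hasCompactSupport_normed.contDiff_convolution_left (n := ⊤) _ η.contDiff_normed
        hφ.locallyIntegrable
    have hφεφ : ∀ p, |φε p - φ p| ≤ γ := fun p => by
      rw [← Real.dist_eq]
      exact η.dist_normed_convolution_le hφ.aestronglyMeasurable fun q hq =>
        (hφδ (lt_of_lt_of_le hq hε2)).le
    have hφε0 : ∀ p : ℝ × Space d, R + 1 < ‖p.2‖ → φε p = 0 := by
      intro p hp
      have h1 : ∀ q ∈ Metric.ball p η.rOut, φ q = 0 := by
        intro q hq
        refine hR q ?_
        have h2 : dist p.2 q.2 ≤ dist q p := by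
          rw [dist_comm]
          exact le_max_right _ _
        have h3 : dist q p < ε := hq
        have h4 : ‖p.2‖ ≤ ‖p.2 - q.2‖ + ‖q.2‖ := by simpa using norm_add_le (p.2 - q.2) q.2
        rw [← dist_eq_norm] at h4
        linarith
      have h5 : dist (φε p) 0 ≤ 0 := dist_convolution_le le_rfl η.support_normed_eq.subset
        η.nonneg_normed η.integral_normed hφ.aestronglyMeasurable
        (fun q hq => by rw [h1 q hq, dist_self])
      exact dist_le_zero.1 h5
    -- the mollified function is almost transported
    have hDφε : ∀ t ∈ tsupport χ, ∀ x, |fderiv ℝ φε (t, x) (1, v t x)|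
        ≤ Λ * Real.exp (C * T) * γ := by
      intro t ht x
      refine abs_fderiv_normed_convolution_le η hφ
        (m := fun h => Λ * Real.exp (C * T) * ((C * h * ‖v t x‖ + γ) * Real.exp (C * h))) ?_ ?_
      · have hc : Continuous fun h : ℝ =>
            Λ * Real.exp (C * T) * ((C * h * ‖v t x‖ + γ) * Real.exp (C * h)) := by fun_prop
        have := hc.tendsto 0
        simp only [mul_zero, zero_mul, zero_add, Real.exp_zero, mul_one] at this
        exact this.mono_left nhdsWithin_le_nhds
      · filter_upwards [Ioo_mem_nhdsGT hε] with h hh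
        rintro ⟨s, y⟩ hy
        have hmax : max (dist s t) (dist y x) < ε := hy
        have hs : |s - t| < ε := (le_max_left _ _).trans_lt hmax
        have hyx : dist y x < ε := (le_max_right _ _).trans_lt hmax
        have hs1 : s ∈ Ioo 0 T := hthick t ht s (by linarith)
        have hs2 : s + h ∈ Ioo 0 T := hthick t ht (s + h) (by
          rw [abs_lt] at hs
          rw [abs_le]
          constructor <;> linarith [hh.1, hh.2, hs.1, hs.2])
        have e1 : φ ((s, y) + h • (1, v t x)) = ψ (Γ (s + h) (y + h • v t x) 0) := by
          have : ((s, y) + h • (1, v t x) : ℝ × Space d) = (s + h, y + h • v t x) := by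
            ext <;> simp
          rw [this]
          exact transported_apply_of_mem hT ψ (Ioo_subset_Icc_self hs2) _
        have e2 : φ (s, y) = ψ (Γ s y 0) :=
          transported_apply_of_mem hT ψ (Ioo_subset_Icc_self hs1) _
        rw [e1, e2]
        refine hΓ.abs_transport_sub_le hv hψ hs1.1.le hh.1.le hs2.2.le fun r hr => ?_
        have := @hvδ (r, y) (t, x) (by
          refine max_lt ?_ (by show dist y x < δ₁; linarith)
          show dist r t < δ₁
          rw [Real.dist_eq]
          rw [abs_lt] at hs ⊢
          constructor <;> linarith [hr.1, hr.2, hs.1, hs.2, hh.2])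
        rw [dist_eq_norm] at this
        exact this.le
    let θ : ℝ × Space d → ℝ := fun p => χ p.1 * φε p
    have hθs : ContDiff ℝ ∞ θ := (hχ.comp contDiff_fst).mul hφεs
    have hθ0 : ∀ p, p ∉ tsupport χ ×ˢ Metric.closedBall (0 : Space d) (R + 1) → θ p = 0 := by
      intro p hp
      rw [mem_prod, not_and_or] at hp
      rcases hp with hp | hp
      · simp only [θ]
        rw [image_eq_zero_of_notMem_tsupport hp, zero_mul]
      · simp only [θ]
        rw [hφε0 p (by simpa using hp), mul_zero]
    have hθc : HasCompactSupport θ :=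
      HasCompactSupport.intro (hχc.isCompact.prod (isCompact_closedBall _ _)) hθ0
    have hθT : tsupport θ ⊆ Ioo 0 T ×ˢ univ := by
      refine (closure_minimal (fun p (hp : θ p ≠ 0) => by_contra fun hn => hp (hθ0 p hn))
        (hχc.isCompact.prod (isCompact_closedBall _ _)).isClosed).trans ?_
      exact prod_mono hχT (subset_univ _)
    let F : ℝ × Space d → ℝ := fun p => fderiv ℝ θ p (1, v p.1 p.2)
    have hFc : Continuous F :=
      (hθs.continuous_fderiv (by simp)).clm_apply (continuous_const.prodMk hvu.continuous)
    have hFs : HasCompactSupport F := by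
      refine (hθc.fderiv ℝ).mono fun p hp => ?_
      contrapose! hp
      simp only [Function.mem_support, not_not] at hp ⊢
      simp [F, hp]
    have hFu : UniformContinuous F := hFs.uniformContinuous_of_continuous hFc
    obtain ⟨MF, hMF⟩ := hFs.exists_bound_of_continuous hFc
    set H : ℝ → ℝ := fun t => ∫ x, F (t, x) ∂(ρ t) with hH
    have hHc : ContinuousOn H (Icc 0 T) := hρc F hFu ⟨MF, hMF⟩
    have hH0 : ∫ t in Ioo 0 T, H t = 0 := by
      refine Eq.trans ?_ (heq θ hθs hθc hθT)
      refine integral_congr_ae (Eventually.of_forall fun t => ?_)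
      refine integral_congr_ae (Eventually.of_forall fun x => ?_)
      exact (deriv_add_fderiv_eq (hθs.differentiable (by simp) (t, x)) (v t x)).symm
    have hFval : ∀ t x, F (t, x) = deriv χ t * φε (t, x) + χ t * fderiv ℝ φε (t, x) (1, v t x) := by
      intro t x
      have h1 : HasFDerivAt (fun p : ℝ × Space d => χ p.1)
          ((ContinuousLinearMap.toSpanSingleton ℝ (deriv χ t)).comp
            (ContinuousLinearMap.fst ℝ ℝ (Space d))) (t, x) := by
        have := (hχ.differentiable (by simp) t).hasDerivAt.hasFDerivAt
        exact this.comp (t, x) hasFDerivAt_fst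
      have h2 := h1.mul (hφεs.differentiable (by simp) (t, x)).hasFDerivAt
      have h3 : fderiv ℝ θ (t, x) = _ := h2.fderiv
      simp only [F]
      rw [h3]
      simp only [add_apply, smul_apply, ContinuousLinearMap.comp_apply,
        ContinuousLinearMap.coe_fst', ContinuousLinearMap.toSpanSingleton_apply, smul_eq_mul,
        one_mul]
      ring
    have hclose : ∀ t ∈ Ioo 0 T, ‖deriv χ t * g t - H t‖
        ≤ (A' + A * (Λ * Real.exp (C * T))) * γ := by
      intro t ht
      have := hρ t (Ioo_subset_Icc_self ht)
      have hFt : Continuous fun x => F (t, x) := by fun_prop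
      have hφt : Continuous fun x => φ (t, x) := by fun_prop
      have i1 : Integrable (fun x => deriv χ t * φ (t, x)) (ρ t) :=
        (Integrable.of_bound hφt.aestronglyMeasurable Mψ
          (Eventually.of_forall fun x => hφb _)).const_mul _
      have i2 : Integrable (fun x => F (t, x)) (ρ t) :=
        Integrable.of_bound hFt.aestronglyMeasurable MF (Eventually.of_forall fun x => hMF _)
      have : deriv χ t * g t - H t = ∫ x, (deriv χ t * φ (t, x) - F (t, x)) ∂(ρ t) := by
        rw [integral_sub i1 i2, integral_const_mul]
      rw [this]
      refine (norm_integral_le_of_norm_le_const (C := (A' + A * (Λ * Real.exp (C * T))) * γ)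
        (Eventually.of_forall fun x => ?_)).trans (by simp)
      rw [hFval]
      have e1 : |deriv χ t * (φ (t, x) - φε (t, x))| ≤ A' * γ := by
        rw [abs_mul, abs_sub_comm]
        exact mul_le_mul (hA' t) (hφεφ _) (abs_nonneg _) hA'0
      have e2 : |χ t * fderiv ℝ φε (t, x) (1, v t x)| ≤ A * (Λ * Real.exp (C * T) * γ) := by
        by_cases hts : t ∈ tsupport χ
        · rw [abs_mul]
          exact mul_le_mul (hA t) (hDφε t hts x) (abs_nonneg _) hA0
        · rw [image_eq_zero_of_notMem_tsupport hts, zero_mul, abs_zero]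
          positivity
      have e3 : deriv χ t * φ (t, x)
          - (deriv χ t * φε (t, x) + χ t * fderiv ℝ φε (t, x) (1, v t x))
          = deriv χ t * (φ (t, x) - φε (t, x)) - χ t * fderiv ℝ φε (t, x) (1, v t x) := by ring
      rw [e3, Real.norm_eq_abs]
      calc _ ≤ _ := abs_sub _ _
        _ ≤ A' * γ + A * (Λ * Real.exp (C * T) * γ) := add_le_add e1 e2
        _ = _ := by ring
    have j1 : IntegrableOn (fun t => deriv χ t * g t) (Ioo 0 T) :=
      ((hχ'.continuousOn.mul hgc).integrableOn_compact isCompact_Icc).mono_set Ioo_subset_Icc_self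
    have j2 : IntegrableOn H (Ioo 0 T) :=
      (hHc.integrableOn_compact isCompact_Icc).mono_set Ioo_subset_Icc_self
    have hsub : ∫ t in Ioo 0 T, deriv χ t * g t = ∫ t in Ioo 0 T, (deriv χ t * g t - H t) := by
      rw [integral_sub j1 j2, hH0, sub_zero]
    rw [hsub, ← Real.norm_eq_abs]
    refine (norm_setIntegral_le_of_norm_le_const (by simp) hclose).trans ?_
    simp [hT]
  by_contra hne
  have hpos : 0 < |∫ t in Ioo 0 T, deriv χ t * g t| := abs_pos.2 hne
  have hlim : Tendsto (fun γ : ℝ => (A' + A * (Λ * Real.exp (C * T))) * γ * T) (𝓝[>] 0) (𝓝 0) := by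
    have hc : Continuous fun γ : ℝ => (A' + A * (Λ * Real.exp (C * T))) * γ * T := by fun_prop
    have := hc.tendsto 0
    simp only [mul_zero, zero_mul] at this
    exact this.mono_left nhdsWithin_le_nhds
  have := ge_of_tendsto hlim (by
    filter_upwards [self_mem_nhdsWithin] with γ hγ
    exact main γ hγ)
  linarith

/-- The Lagrangian representation: a solution of the continuity equation with a Lipschitz field is
the image of its initial value under the flow. -/
theorem eq_map_flow (hT : 0 ≤ T) (hΓ : IsFlow T v Γ)
    (hv : ∀ t, LipschitzWith C (v t)) (hvu : UniformContinuous (Function.uncurry v))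
    (hρ : ∀ t ∈ Icc 0 T, IsProbabilityMeasure (ρ t)) (hρc : NarrowlyContinuous T ρ)
    (heq : ContinuityEq T ρ v) {t : ℝ} (ht : t ∈ Icc 0 T) :
    ρ t = (ρ 0).map (fun y => Γ 0 y t) := by
  have h0 : (0 : ℝ) ∈ Icc 0 T := ⟨le_rfl, hT⟩
  have := hρ t ht
  have := hρ 0 h0
  have hX : Continuous fun y => Γ 0 y t := (hΓ.lipschitzWith_apply hv h0 ht).continuous
  have hY : Continuous fun x => Γ t x 0 := (hΓ.lipschitzWith_apply hv ht h0).continuous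
  have hback : (ρ t).map (fun x => Γ t x 0) = ρ 0 := by
    refine eq_of_forall_integral_lipschitz_eq fun ψ ⟨Λ, hψ⟩ hψc => ?_
    obtain ⟨M, hM⟩ := hψc.exists_bound_of_continuous hψ.continuous
    have key := eq_of_forall_integral_deriv_mul_eq_zero
      (g := fun t => ∫ x, transported T hT Γ ψ (t, x) ∂(ρ t))
      (hρc _ (uniformContinuous_transported hT hΓ hv hψ.continuous hψc) ⟨M, fun p => hM _⟩)
      (fun χ h1 h2 h3 => integral_deriv_mul_integral_transported_eq_zero hT hΓ hv hvu hρ hρc heq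
        hψ hψc h1 h2 h3) t ht
    simp only [transported_apply_of_mem hT ψ ht, transported_apply_of_mem hT ψ h0,
      hΓ.apply_self 0 h0] at key
    rw [integral_map hY.aemeasurable hψ.continuous.aestronglyMeasurable, key]
  rw [← hback, Measure.map_map hX.measurable hY.measurable]
  have : (fun y => Γ 0 y t) ∘ (fun x => Γ t x 0) = id :=
    funext fun x => hΓ.apply_apply_self hv ht h0 x
  rw [this, Measure.map_id]

end Representation

/-! ### Lipschitz representatives of functions in `W^{1,∞}` -/

section Sobolev

open scoped NNReal Convolution
open ContinuousLinearMap (lsmul)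

variable {d : ℕ}

theorem sum_smul_single (x : Space d) : ∑ i, x i • EuclideanSpace.single i (1 : ℝ) = x := by
  simpa using (EuclideanSpace.basisFun (Fin d) ℝ).sum_repr x

theorem norm_le_sum_abs (x : Space d) : ‖x‖ ≤ ∑ i, |x i| := by
  conv_lhs => rw [← sum_smul_single x]
  refine (norm_sum_le _ _).trans (Finset.sum_le_sum fun i _ => ?_)
  simp [norm_smul]

/-- Mollification commutes with weak derivatives. -/
theorem fderiv_normed_convolution_single (η : ContDiffBump (0 : Space d)) {i : Fin d}
    {f g : Space d → ℝ} (h : IsWeakPartial i f g) (x : Space d) :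
    fderiv ℝ (η.normed volume ⋆[lsmul ℝ ℝ, volume] f) x (EuclideanSpace.single i 1)
      = ∫ y, g y * η.normed volume (x - y) := by
  have hη : ContDiff ℝ ∞ (η.normed (volume : Measure (Space d))) := η.contDiff_normed (n := ⊤)
  have hη1 : ContDiff ℝ 1 (η.normed (volume : Measure (Space d))) := η.contDiff_normed (n := 1)
  have hd := η.hasCompactSupport_normed.hasFDerivAt_convolution_left (lsmul ℝ ℝ) hη1 h.1 x
  have hex : ConvolutionExistsAt (fderiv ℝ (η.normed (volume : Measure (Space d)))) f x
      ((lsmul ℝ ℝ).precompL (Space d)) volume :=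
    (η.hasCompactSupport_normed.fderiv ℝ).convolutionExists_left _
      (hη1.continuous_fderiv one_ne_zero) h.1 x
  unfold ConvolutionExistsAt at hex
  rw [hd.fderiv, convolution_def, ContinuousLinearMap.integral_apply hex]
  let φ : Space d → ℝ := fun y => η.normed volume (x - y)
  have hφ : ContDiff ℝ ∞ φ := hη.comp (contDiff_const.sub contDiff_id)
  have hφc : HasCompactSupport φ := by
    refine HasCompactSupport.intro (K := Metric.closedBall x η.rOut) (isCompact_closedBall _ _)
      fun y hy => ?_
    simp only [φ]
    rw [← Function.notMem_support, η.support_normed_eq, Metric.mem_ball, dist_zero_right,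
      ← dist_eq_norm, dist_comm]
    rw [Metric.mem_closedBall] at hy
    exact fun hlt => hy hlt.le
  have hφd : ∀ y w, fderiv ℝ φ y w = - fderiv ℝ (η.normed volume) (x - y) w := by
    intro y w
    have h1 : HasFDerivAt (fun y : Space d => x - y) (-ContinuousLinearMap.id ℝ (Space d)) y :=
      (hasFDerivAt_id y).const_sub x
    have h2 : HasFDerivAt φ _ y :=
      (hη1.differentiable one_ne_zero (x - y)).hasFDerivAt.comp y h1
    rw [h2.fderiv]
    simp
  have key := h.2.2 φ hφ hφc
  simp only [hφd, mul_neg, integral_neg, neg_inj] at key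
  rw [← key]
  rw [← integral_sub_left_eq_self _ volume x]
  refine integral_congr_ae (Eventually.of_forall fun y => ?_)
  simp [ContinuousLinearMap.precompL_apply, mul_comm]

theorem exists_ae_abs_le_of_memLp_top {g : Space d → ℝ} (h : MemLp g ∞ volume) :
    ∃ M : ℝ≥0, ∀ᵐ x, |g x| ≤ M := by
  refine ⟨(eLpNorm g ∞ volume).toNNReal, ?_⟩
  rw [eLpNorm_exponent_top]
  filter_upwards [ae_le_eLpNormEssSup (f := g) (μ := volume)] with x hx
  have hfin : eLpNormEssSup g volume ≠ ⊤ := by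
    rw [← eLpNorm_exponent_top]
    exact h.2.ne
  rw [← ENNReal.coe_toNNReal hfin] at hx
  exact_mod_cast (ENNReal.coe_le_coe.1 hx)

/-- A function in `W^{1,∞}` has a bounded Lipschitz representative. -/
theorem MemW1Infty.exists_lipschitz {f : Space d → ℝ} (hf : MemW1Infty f) :
    ∃ g : Space d → ℝ, f =ᵐ[volume] g ∧ (∃ L, LipschitzWith L g) ∧ ∃ M, ∀ x, |g x| ≤ M := by
  obtain ⟨hfb, hf'⟩ := hf
  choose p hp hfp using hf'
  obtain ⟨M, hM⟩ := exists_ae_abs_le_of_memLp_top hfb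
  choose N hN using fun i => exists_ae_abs_le_of_memLp_top (hp i)
  have hfl : LocallyIntegrable f volume := hfb.locallyIntegrable le_top
  let η : ℕ → ContDiffBump (0 : Space d) := fun n =>
    ⟨1 / (2 * (n + 1)), 1 / (n + 1), by positivity, by
      apply one_div_lt_one_div_of_lt <;> linarith [n.cast_nonneg (α := ℝ)]⟩
  have hη : Tendsto (fun n => (η n).rOut) atTop (𝓝 0) := tendsto_one_div_add_atTop_nhds_zero_nat
  have hη2 : ∀ᶠ n in atTop, (η n).rOut ≤ 2 * (η n).rIn := Eventually.of_forall fun n => by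
    simp only [η]
    have : (0 : ℝ) < n + 1 := by positivity
    apply le_of_eq
    field_simp
  let F : ℕ → Space d → ℝ := fun n => (η n).normed volume ⋆[lsmul ℝ ℝ, volume] f
  have hFs : ∀ n, ContDiff ℝ 1 (F n) := fun n =>
    (η n).hasCompactSupport_normed.contDiff_convolution_left (n := 1) _ (η n).contDiff_normed hfl
  have hpart : ∀ n x i, |fderiv ℝ (F n) x (EuclideanSpace.single i 1)| ≤ N i := by
    intro n x i
    simp only [F]
    rw [fderiv_normed_convolution_single (η n) (hfp i) x, ← Real.norm_eq_abs]
    have e : ∫ y, (N i : ℝ) * (η n).normed volume (x - y) = N i := by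
      rw [integral_const_mul, integral_sub_left_eq_self (fun y => (η n).normed volume y) volume x,
        (η n).integral_normed, mul_one]
    refine (norm_integral_le_of_norm_le
      (((η n).integrable_normed.comp_sub_left x).const_mul (N i : ℝ)) ?_).trans e.le
    filter_upwards [hN i] with y hy
    rw [norm_mul, Real.norm_of_nonneg ((η n).nonneg_normed _)]
    exact mul_le_mul_of_nonneg_right hy ((η n).nonneg_normed _)
  have hFL : ∀ n, LipschitzWith (∑ i, N i) (F n) := by
    intro n
    refine lipschitzWith_of_nnnorm_fderiv_le ((hFs n).differentiable one_ne_zero) fun x => ?_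
    refine ContinuousLinearMap.opNorm_le_bound _ (NNReal.coe_nonneg _) fun w => ?_
    change ‖fderiv ℝ (F n) x w‖ ≤ ((∑ i, N i : ℝ≥0) : ℝ) * ‖w‖
    conv_lhs => rw [← sum_smul_single w]
    rw [map_sum]
    push_cast
    rw [Finset.sum_mul]
    refine (norm_sum_le _ _).trans (Finset.sum_le_sum fun i _ => ?_)
    rw [map_smul, smul_eq_mul, norm_mul, mul_comm]
    exact mul_le_mul (hpart n x i) (PiLp.norm_apply_le w i) (norm_nonneg _) (N i).2
  set A : Set (Space d) := {x | Tendsto (fun n => F n x) atTop (𝓝 (f x))} with hA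
  have hAae : ∀ᵐ x, x ∈ A :=
    ContDiffBump.ae_convolution_tendsto_right_of_locallyIntegrable hη hη2 hfl
  have hfA : LipschitzOnWith (∑ i, N i) f A := LipschitzOnWith.of_dist_le_mul fun x hx y hy =>
    le_of_tendsto (hx.dist hy) (Eventually.of_forall fun n => (hFL n).dist_le_mul x y)
  obtain ⟨g, hg, hfg⟩ := hfA.extend_real
  have hae : f =ᵐ[volume] g := hAae.mono hfg
  refine ⟨g, hae, ⟨_, hg⟩, M, fun x => ?_⟩
  have hcl : IsClosed {x | |g x| ≤ M} := isClosed_le hg.continuous.abs continuous_const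
  have hd : Dense {x | |g x| ≤ M} := Measure.dense_of_ae (μ := volume) (by
    filter_upwards [hM, hae] with y h1 h2
    show |g y| ≤ M
    rwa [← h2])
  have : x ∈ closure {x | |g x| ≤ M} := hd x
  rwa [hcl.closure_eq] at this

/-- If `∇W ∈ W^{1,∞}`, its continuous representative is bounded and Lipschitz. -/
theorem GradMemW1Infty.contGrad_bounded_lipschitz {W : Space d → ℝ} (hW : GradMemW1Infty W) :
    ∃ (B : ℝ) (L : ℝ≥0), (∀ x, ‖contGrad W x‖ ≤ B) ∧ LipschitzWith L (contGrad W) := by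
  obtain ⟨-, G, hG, hG1⟩ := hW
  choose g hfg hgL hgM using fun i => (hG1 i).exists_lipschitz
  choose L hL using hgL
  choose M hM using hgM
  let H : Space d → Space d := fun x => WithLp.toLp 2 fun i => g i x
  have hHL : LipschitzWith (∑ i, L i) H := LipschitzWith.of_dist_le_mul fun x y => by
    rw [dist_eq_norm]
    push_cast
    rw [Finset.sum_mul]
    exact (norm_le_sum_abs _).trans (Finset.sum_le_sum fun i _ => (hL i).dist_le_mul x y)
  have hH : IsWeakGradient W H := by
    intro i
    obtain ⟨h1, h2, h3⟩ := hG i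
    refine ⟨h1, (hL i).continuous.locallyIntegrable, fun φ hφ hφc => ?_⟩
    rw [h3 φ hφ hφc]
    congr 1
    refine integral_congr_ae ?_
    filter_upwards [hfg i] with x hx
    simp only [H]
    rw [hx]
  have hex : ∃ G : Space d → Space d, Continuous G ∧ IsWeakGradient W G := ⟨H, hHL.continuous, hH⟩
  have heq : contGrad W = H := by
    unfold contGrad
    rw [dif_pos hex]
    exact hex.choose_spec.2.eq_of_continuous hH hex.choose_spec.1 hHL.continuous
  rw [heq]
  exact ⟨∑ i, M i, ∑ i, L i, fun x => (norm_le_sum_abs _).trans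
    (Finset.sum_le_sum fun i _ => hM i x), hHL⟩

end Sobolev

/-! ### The Wasserstein distance and the velocity field -/

section Wasserstein

variable {d : ℕ} {G : Type*} [NormedAddCommGroup G] [NormedSpace ℝ G]

theorem MemP2.integrable_norm_sq {μ : Measure (Space d)} (h : MemP2 μ) :
    Integrable (fun x => ‖x‖ ^ 2) μ := by
  refine ⟨by fun_prop, ?_⟩
  rw [hasFiniteIntegral_iff_enorm]
  simpa [enorm_pow] using h.2

theorem MemP2.integrable_norm {μ : Measure (Space d)} (h : MemP2 μ) :
    Integrable (fun x => ‖x‖) μ := by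
  have := h.1
  refine ((integrable_const (1 : ℝ)).add h.integrable_norm_sq).mono' (by fun_prop)
    (Eventually.of_forall fun x => ?_)
  simp only [norm_norm, Pi.add_apply]
  nlinarith [sq_nonneg (‖x‖ - 1), norm_nonneg x]

/-- If `f x` and `g y` are `η`-close whenever `x` and `y` are `δ`-close, their integrals against
two measures are close in terms of the Wasserstein distance of the measures. -/
theorem norm_integral_sub_integral_le {μ ν : Measure (Space d)} [IsProbabilityMeasure μ] {c : ℝ}
    (hc : 0 ≤ c) (hW : W2 μ ν < ENNReal.ofReal c) {f g : Space d → G} (hf : Continuous f)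
    (hg : Continuous g) {M δ η : ℝ} (hfM : ∀ x, ‖f x‖ ≤ M) (hgM : ∀ x, ‖g x‖ ≤ M) (hδ : 0 < δ)
    (hη : 0 ≤ η) (h : ∀ x y, ‖x - y‖ < δ → ‖f x - g y‖ ≤ η) :
    ‖∫ x, f x ∂μ - ∫ y, g y ∂ν‖ ≤ η + 2 * M / δ ^ 2 * c ^ 2 := by
  obtain ⟨⟨π, hπμ, hπν⟩, hπ⟩ := iInf_lt_iff.1 hW
  simp only at hπ
  have hM : 0 ≤ M := (norm_nonneg _).trans (hfM 0)
  have hprob : IsProbabilityMeasure π := by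
    constructor
    have : π.map Prod.fst univ = 1 := by rw [hπμ]; exact measure_univ
    rwa [Measure.map_apply measurable_fst MeasurableSet.univ, preimage_univ] at this
  have hlin : ∫⁻ p, ‖p.1 - p.2‖ₑ ^ 2 ∂π ≤ ENNReal.ofReal (c ^ 2) := by
    have h1 := ENNReal.rpow_le_rpow hπ.le (z := 2) (by norm_num)
    rw [← ENNReal.rpow_mul] at h1
    norm_num at h1
    rwa [ENNReal.ofReal_pow hc]
  have hint : Integrable (fun p : Space d × Space d => ‖p.1 - p.2‖ ^ 2) π := by
    refine ⟨by fun_prop, ?_⟩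
    rw [hasFiniteIntegral_iff_enorm]
    simp only [enorm_pow, enorm_norm]
    exact hlin.trans_lt ENNReal.ofReal_lt_top
  have hint2 : ∫ p, ‖p.1 - p.2‖ ^ 2 ∂π ≤ c ^ 2 := by
    rw [integral_eq_lintegral_of_nonneg_ae (Eventually.of_forall fun p => by positivity)
      (by fun_prop)]
    refine ENNReal.toReal_le_of_le_ofReal (by positivity) (le_trans (le_of_eq ?_) hlin)
    refine lintegral_congr fun p => ?_
    rw [← ofReal_norm, ENNReal.ofReal_pow (norm_nonneg _)]
  have e1 : ∫ x, f x ∂μ = ∫ p, f p.1 ∂π := by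
    rw [← hπμ, integral_map measurable_fst.aemeasurable hf.aestronglyMeasurable]
  have e2 : ∫ x, g x ∂ν = ∫ p, g p.2 ∂π := by
    rw [← hπν, integral_map measurable_snd.aemeasurable hg.aestronglyMeasurable]
  have i1 : Integrable (fun p : Space d × Space d => f p.1) π :=
    Integrable.of_bound (hf.comp continuous_fst).aestronglyMeasurable M
      (Eventually.of_forall fun p => hfM _)
  have i2 : Integrable (fun p : Space d × Space d => g p.2) π :=
    Integrable.of_bound (hg.comp continuous_snd).aestronglyMeasurable M
      (Eventually.of_forall fun p => hgM _)
  rw [e1, e2, ← integral_sub i1 i2]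
  refine (norm_integral_le_of_norm_le ((integrable_const η).add (hint.const_mul (2 * M / δ ^ 2)))
    (Eventually.of_forall fun p => ?_)).trans ?_
  · simp only [Pi.add_apply]
    rcases lt_or_ge ‖p.1 - p.2‖ δ with hlt | hge
    · exact (h _ _ hlt).trans (le_add_of_nonneg_right (by positivity))
    · have h1 : ‖f p.1 - g p.2‖ ≤ 2 * M := by
        linarith [norm_sub_le (f p.1) (g p.2), hfM p.1, hgM p.2]
      have h2 : 2 * M ≤ 2 * M / δ ^ 2 * ‖p.1 - p.2‖ ^ 2 := by
        rw [div_mul_eq_mul_div, le_div_iff₀ (by positivity)]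
        gcongr
      linarith
  · simp only [Pi.add_apply]
    rw [integral_add (integrable_const η) (hint.const_mul _), integral_const_mul]
    simp only [integral_const, probReal_univ, one_smul]
    gcongr

/-- Along a `W₂`-continuous curve, integrals of uniformly bounded and uniformly equicontinuous
integrands vary continuously, uniformly over the integrands. -/
theorem ContinuousP2.eventually_norm_integral_sub_le {T : ℝ} {ρ : ℝ → Measure (Space d)}
    (hρ : ContinuousP2 T ρ) {t : ℝ} (ht : t ∈ Icc 0 T) {M δ η : ℝ} (hδ : 0 < δ)
    (hη : 0 < η) :
    ∀ᶠ s in 𝓝[Icc 0 T] t, ∀ f g : Space d → G, Continuous f → Continuous g →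
      (∀ x, ‖f x‖ ≤ M) → (∀ x, ‖g x‖ ≤ M) → (∀ x y, ‖x - y‖ < δ → ‖f x - g y‖ ≤ η) →
      ‖∫ x, f x ∂(ρ s) - ∫ y, g y ∂(ρ t)‖ ≤ 2 * η := by
  obtain ⟨c, hc, hcη⟩ : ∃ c > 0, 2 * M / δ ^ 2 * c ^ 2 ≤ η := by
    have hcont : Continuous fun c : ℝ => 2 * M / δ ^ 2 * c ^ 2 := by fun_prop
    have := hcont.tendsto 0
    simp only [ne_eq, OfNat.ofNat_ne_zero, not_false_eq_true, zero_pow, mul_zero] at this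
    have h2 := (this.mono_left (nhdsWithin_le_nhds (s := Ioi 0))).eventually (eventually_lt_nhds hη)
    obtain ⟨c, h3, h4⟩ := (h2.and self_mem_nhdsWithin).exists
    exact ⟨c, h4, h3.le⟩
  filter_upwards [(hρ.2 t ht).eventually (eventually_lt_nhds (ENNReal.ofReal_pos.2 hc)),
    self_mem_nhdsWithin] with s hs hsT f g hf hg hfM hgM hfg
  have := (hρ.1 s hsT).1
  linarith [norm_integral_sub_integral_le hc.le hs hf hg hfM hgM hδ hη.le hfg]

theorem ContinuousP2.narrowlyContinuous {T : ℝ} {ρ : ℝ → Measure (Space d)}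
    (hρ : ContinuousP2 T ρ) : NarrowlyContinuous T ρ := by
  rintro F hF ⟨M, hM⟩ t ht
  rw [ContinuousWithinAt, Metric.tendsto_nhds]
  intro η hη
  obtain ⟨δ, hδ, hFδ⟩ := Metric.uniformContinuous_iff.1 hF (η / 3) (by positivity)
  filter_upwards [hρ.eventually_norm_integral_sub_le (G := ℝ) ht hδ
    (show 0 < η / 3 by positivity), mem_nhdsWithin_of_mem_nhds (Metric.ball_mem_nhds t hδ)]
    with s hs hst
  have hc := hF.continuous
  have := hs (fun x => F (s, x)) (fun x => F (t, x)) (by fun_prop) (by fun_prop) (fun x => hM _)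
    (fun x => hM _) (fun x y hxy => by
      have := @hFδ (s, x) (t, y) (max_lt hst (by rwa [dist_eq_norm]))
      rw [dist_eq_norm] at this
      exact this.le)
  rw [dist_eq_norm]
  linarith

end Wasserstein

section Velocity

open scoped NNReal BoundedContinuousFunction

variable {d : ℕ}

theorem gradient_confinement (x : Space d) : gradient confinement x = x := by
  refine HasGradientAt.gradient ?_
  rw [hasGradientAt_iff_hasFDerivAt]
  have h := ((hasStrictFDerivAt_norm_sq x).hasFDerivAt).const_mul (1 / 2 : ℝ)
  have e : (fun y : Space d => 1 / 2 * ‖y‖ ^ 2) = confinement := by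
    funext y
    simp only [confinement]
    ring
  rw [← e]
  refine h.congr_fderiv ?_
  ext y
  simp

theorem velocity_eq (κ : ℝ) (W : Space d → ℝ) (ρ : ℝ → Measure (Space d)) (t : ℝ) (x : Space d) :
    velocity κ W ρ t x = -(κ • x) + -(κ • ∫ y, contGrad W (x - y) ∂(ρ t)) := by
  rw [velocity, gradient_confinement, smul_add, neg_add]

variable {K : Space d → Space d} {B : ℝ} {L : ℝ≥0}

theorem norm_integral_kernel_le (hB : ∀ x, ‖K x‖ ≤ B) (μ : Measure (Space d))
    [IsProbabilityMeasure μ] (x : Space d) : ‖∫ y, K (x - y) ∂μ‖ ≤ B :=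
  (norm_integral_le_of_norm_le_const (Eventually.of_forall fun y => hB _)).trans (by simp)

theorem integrable_kernel (hB : ∀ x, ‖K x‖ ≤ B) (hL : LipschitzWith L K) (μ : Measure (Space d))
    [IsProbabilityMeasure μ] (x : Space d) : Integrable (fun y => K (x - y)) μ :=
  Integrable.of_bound ((hL.continuous.comp (by fun_prop)).aestronglyMeasurable) B
    (Eventually.of_forall fun y => hB _)

theorem lipschitzWith_integral_kernel (hB : ∀ x, ‖K x‖ ≤ B) (hL : LipschitzWith L K)
    (μ : Measure (Space d)) [IsProbabilityMeasure μ] :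
    LipschitzWith L (fun x => ∫ y, K (x - y) ∂μ) := by
  refine LipschitzWith.of_dist_le_mul fun x x' => ?_
  rw [dist_eq_norm, ← integral_sub (integrable_kernel hB hL μ x) (integrable_kernel hB hL μ x')]
  refine (norm_integral_le_of_norm_le_const (C := L * dist x x')
    (Eventually.of_forall fun y => ?_)).trans (by simp)
  rw [← dist_eq_norm]
  exact (hL.dist_le_mul _ _).trans (by simp)

variable {κ T : ℝ} {W : Space d → ℝ} {ρ : ℝ → Measure (Space d)}

/-- The velocity field, extended to all times by its values at the times `0` and `T`. -/
noncomputable def extVelocity (κ T : ℝ) (hT : 0 ≤ T) (W : Space d → ℝ)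
    (ρ : ℝ → Measure (Space d)) (t : ℝ) (x : Space d) : Space d :=
  velocity κ W ρ (projIcc 0 T hT t : Icc (0 : ℝ) T) x

theorem extVelocity_of_mem (hT : 0 ≤ T) {t : ℝ} (ht : t ∈ Icc 0 T) (x : Space d) :
    extVelocity κ T hT W ρ t x = velocity κ W ρ t x := by
  rw [extVelocity, projIcc_of_mem hT ht]

theorem lipschitzWith_extVelocity (hκ : 0 < κ) (hT : 0 ≤ T) (hρ : ContinuousP2 T ρ)
    (hB : ∀ x, ‖contGrad W x‖ ≤ B) (hL : LipschitzWith L (contGrad W)) (t : ℝ) :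
    LipschitzWith (⟨κ, hκ.le⟩ * (1 + L)) (extVelocity κ T hT W ρ t) := by
  have := (hρ.1 _ (projIcc 0 T hT t).2).1
  refine LipschitzWith.of_dist_le_mul fun x y => ?_
  rw [extVelocity, extVelocity, velocity_eq, velocity_eq]
  have h := (lipschitzWith_integral_kernel hB hL (ρ (projIcc 0 T hT t : Icc (0 : ℝ) T))).dist_le_mul
    x y
  refine (dist_add_add_le _ _ _ _).trans ?_
  rw [dist_neg_neg, dist_neg_neg, dist_smul₀, dist_smul₀, Real.norm_of_nonneg hκ.le]
  change _ ≤ κ * (1 + (L : ℝ)) * dist x y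
  calc _ ≤ κ * dist x y + κ * (L * dist x y) :=
        add_le_add le_rfl (mul_le_mul_of_nonneg_left h hκ.le)
    _ = _ := by ring

/-- The velocity field is uniformly continuous in time and space: the convolution depends
continuously on time, uniformly in space, and the time interval is compact. -/
theorem uniformContinuous_extVelocity (hκ : 0 < κ) (hT : 0 ≤ T) (hρ : ContinuousP2 T ρ)
    (hB : ∀ x, ‖contGrad W x‖ ≤ B) (hL : LipschitzWith L (contGrad W)) :
    UniformContinuous (Function.uncurry (extVelocity κ T hT W ρ)) := by
  have hprob : ∀ t : Icc (0 : ℝ) T, IsProbabilityMeasure (ρ t) := fun t => (hρ.1 t t.2).1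
  let b : Icc (0 : ℝ) T → Space d →ᵇ Space d := fun t =>
    BoundedContinuousFunction.ofNormedAddCommGroup (fun x => ∫ y, contGrad W (x - y) ∂(ρ t))
      (lipschitzWith_integral_kernel hB hL (ρ t)).continuous B (norm_integral_kernel_le hB (ρ t))
  have hb : Continuous b := by
    rw [continuous_iff_continuousAt]
    intro t
    rw [ContinuousAt, Metric.tendsto_nhds]
    intro η hη
    obtain ⟨δ, hδ, hδη⟩ : ∃ δ > 0, L * δ ≤ η / 3 :=
      ⟨η / 3 / (L + 1), by positivity, by
        rw [mul_div_assoc', div_le_iff₀ (by positivity)]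
        nlinarith [L.2]⟩
    have hev := (hρ.eventually_norm_integral_sub_le (G := Space d) (M := B) t.2 hδ
      (show 0 < η / 3 by positivity))
    rw [← map_nhds_subtype_val t, eventually_map] at hev
    filter_upwards [hev] with s hs
    refine lt_of_le_of_lt ((BoundedContinuousFunction.dist_le
      (show 0 ≤ 2 * (η / 3) by positivity)).2 fun x => ?_) (by linarith)
    rw [dist_eq_norm]
    refine hs (fun y => contGrad W (x - y)) (fun y => contGrad W (x - y))
      (hL.continuous.comp (by fun_prop)) (hL.continuous.comp (by fun_prop))
      (fun _ => hB _) (fun _ => hB _) (fun y z hyz => ?_)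
    refine (hL.norm_sub_le _ _).trans (le_trans ?_ hδη)
    rw [sub_sub_sub_cancel_left, norm_sub_rev]
    gcongr
  have hbu : UniformContinuous fun t => b (projIcc 0 T hT t) :=
    (CompactSpace.uniformContinuous_of_continuous hb).comp (LipschitzWith.projIcc hT).uniformContinuous
  have hlip := lipschitzWith_extVelocity hκ hT hρ hB hL
  rw [Metric.uniformContinuous_iff] at hbu ⊢
  intro η hη
  obtain ⟨δ, hδ, hbδ⟩ := hbu (η / (2 * κ)) (by positivity)
  refine ⟨min δ (η / (2 * (κ * (1 + L)))), by positivity, fun ⟨s, x⟩ ⟨t, y⟩ hst => ?_⟩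
  have hmax : max (dist s t) (dist x y) < min δ (η / (2 * (κ * (1 + L)))) := hst
  have hs : dist s t < δ := (le_max_left _ _).trans_lt (hmax.trans_le (min_le_left _ _))
  have hx : dist x y < η / (2 * (κ * (1 + L))) :=
    (le_max_right _ _).trans_lt (hmax.trans_le (min_le_right _ _))
  have h1 : dist (extVelocity κ T hT W ρ s x) (extVelocity κ T hT W ρ s y) < η / 2 := by
    have := (hlip s).dist_le_mul x y
    have e : ((⟨κ, hκ.le⟩ * (1 + L) : ℝ≥0) : ℝ) = κ * (1 + L) := rfl
    rw [e] at this
    refine this.trans_lt ?_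
    rw [lt_div_iff₀ (by positivity)] at hx
    linarith
  have h2 : dist (extVelocity κ T hT W ρ s y) (extVelocity κ T hT W ρ t y) < η / 2 := by
    have h3 := (BoundedContinuousFunction.dist_coe_le_dist (f := b (projIcc 0 T hT s))
      (g := b (projIcc 0 T hT t)) y).trans_lt (hbδ hs)
    rw [extVelocity, extVelocity, velocity_eq, velocity_eq, dist_add_left, dist_neg_neg,
      dist_smul₀, Real.norm_of_nonneg hκ.le]
    have h4 : dist (∫ z, contGrad W (y - z) ∂(ρ (projIcc 0 T hT s : Icc (0 : ℝ) T)))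
      (∫ z, contGrad W (y - z) ∂(ρ (projIcc 0 T hT t : Icc (0 : ℝ) T))) < η / (2 * κ) := h3
    rw [lt_div_iff₀ (by positivity)] at h4
    linarith
  calc _ ≤ _ := dist_triangle _ (extVelocity κ T hT W ρ s y) _
    _ < η := by
      have := add_lt_add h1 h2
      simpa using this

/-- The velocity field of a `W₂`-continuous curve has a flow on `[0, T]`. -/
theorem exists_isFlow_extVelocity (hκ : 0 < κ) (hT : 0 ≤ T) (hρ : ContinuousP2 T ρ)
    (hB : ∀ x, ‖contGrad W x‖ ≤ B) (hL : LipschitzWith L (contGrad W)) :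
    ∃ Γ, IsFlow T (extVelocity κ T hT W ρ) Γ := by
  have hcu := (uniformContinuous_extVelocity hκ hT hρ hB hL).continuous
  have hprob : ∀ t : ℝ, IsProbabilityMeasure (ρ (projIcc 0 T hT t : Icc (0 : ℝ) T)) :=
    fun t => (hρ.1 _ (projIcc 0 T hT t).2).1
  have hex : ∀ s ∈ Icc 0 T, ∀ x : Space d, ∃ α : ℝ → Space d, α s = x ∧
      IsTrajectory T (extVelocity κ T hT W ρ) α := by
    intro s hs x
    obtain ⟨α, h1, h2⟩ := exists_isTrajectory (κ := κ) (B := κ * B) (C := ⟨κ, hκ.le⟩ * L)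
      (b := fun t x => -(κ • ∫ y, contGrad W (x - y) ∂(ρ (projIcc 0 T hT t : Icc (0 : ℝ) T))))
      (fun t x => by
        rw [norm_neg, norm_smul, Real.norm_of_nonneg hκ.le]
        exact mul_le_mul_of_nonneg_left (norm_integral_kernel_le hB _ x) hκ.le)
      (fun t => LipschitzWith.of_dist_le_mul fun x y => by
        rw [dist_neg_neg, dist_smul₀, Real.norm_of_nonneg hκ.le]
        have := mul_le_mul_of_nonneg_left ((lipschitzWith_integral_kernel hB hL
          (ρ (projIcc 0 T hT t : Icc (0 : ℝ) T))).dist_le_mul x y) hκ.le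
        rw [← mul_assoc] at this
        exact this)
      (fun x => by
        have h3 : Continuous fun t => extVelocity κ T hT W ρ t x + κ • x :=
          (hcu.comp (by fun_prop : Continuous fun t : ℝ => (t, x))).add continuous_const
        refine h3.congr fun t => ?_
        rw [extVelocity, velocity_eq]
        abel) hs x
    refine ⟨α, h1, fun t ht => ?_⟩
    have := h2 t ht
    rwa [extVelocity, velocity_eq]
  choose! Γ h1 h2 using hex
  exact ⟨Γ, h1, h2⟩

theorem IsWeakSolution.continuityEq_extVelocity {ρ₀ : Measure (Space d)} (hT : 0 ≤ T)
    (h : IsWeakSolution κ T W ρ₀ ρ) : ContinuityEq T ρ (extVelocity κ T hT W ρ) := by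
  intro φ h1 h2 h3
  refine Eq.trans ?_ (h.continuityEq φ h1 h2 h3)
  refine setIntegral_congr_fun measurableSet_Ioo fun t ht => ?_
  simp only [extVelocity_of_mem hT (Ioo_subset_Icc_self ht)]

/-- A weak solution is the image of its initial value under the flow of its velocity field. -/
theorem IsWeakSolution.eq_map_flow {ρ₀ : Measure (Space d)} (hκ : 0 < κ) (hT : 0 ≤ T)
    (hB : ∀ x, ‖contGrad W x‖ ≤ B) (hL : LipschitzWith L (contGrad W))
    (h : IsWeakSolution κ T W ρ₀ ρ) {Γ : ℝ → Space d → ℝ → Space d}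
    (hΓ : IsFlow T (extVelocity κ T hT W ρ) Γ) {t : ℝ} (ht : t ∈ Icc 0 T) :
    ρ t = ρ₀.map (fun y => Γ 0 y t) := by
  rw [← h.initial]
  exact Aggregation.eq_map_flow hT hΓ (lipschitzWith_extVelocity hκ hT h.continuousP2 hB hL)
    (uniformContinuous_extVelocity hκ hT h.continuousP2 hB hL)
    (fun t ht => (h.continuousP2.1 t ht).1) h.continuousP2.narrowlyContinuous
    (h.continuityEq_extVelocity hT) ht

end Velocity

/-! ### Existence: the mean field equation -/

section Existence

open scoped NNReal BoundedContinuousFunction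

variable {d : ℕ} {T : ℝ} {v : ℝ → Space d → Space d} {C : ℝ≥0} {Γ : ℝ → Space d → ℝ → Space d}

/-- The image of a measure under the flow of `v` solves the continuity equation with field `v`. -/
theorem continuityEq_of_eq_map_flow (hT : 0 ≤ T) (hΓ : IsFlow T v Γ)
    (hv : ∀ t, LipschitzWith C (v t)) (hvc : Continuous (Function.uncurry v))
    {ρ : ℝ → Measure (Space d)} {ρ₀ : Measure (Space d)} [IsProbabilityMeasure ρ₀]
    (hρ : ∀ t ∈ Icc 0 T, ρ t = ρ₀.map (fun y => Γ 0 y t)) : ContinuityEq T ρ v := by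
  intro φ hφ hφc hφT
  have h0 : (0 : ℝ) ∈ Icc 0 T := ⟨le_rfl, hT⟩
  let F : ℝ × Space d → ℝ := fun p => fderiv ℝ φ p (1, v p.1 p.2)
  have hFc : Continuous F :=
    (hφ.continuous_fderiv (by simp)).clm_apply (continuous_const.prodMk hvc)
  have hFs : HasCompactSupport F := by
    refine (hφc.fderiv ℝ).mono fun p hp => ?_
    contrapose! hp
    simp only [Function.mem_support, not_not] at hp ⊢
    simp [F, hp]
  obtain ⟨M, hM⟩ := hFs.exists_bound_of_continuous hFc
  let P : ℝ → Space d → ℝ := fun t y => F ((projIcc 0 T hT t : Icc (0 : ℝ) T),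
    Γ 0 y (projIcc 0 T hT t : Icc (0 : ℝ) T))
  have hproj : Continuous fun p : ℝ × Space d => ((projIcc 0 T hT p.1 : Icc (0 : ℝ) T) : ℝ) :=
    continuous_subtype_val.comp (continuous_projIcc.comp continuous_fst)
  have hP : Continuous (Function.uncurry P) := by
    refine hFc.comp (hproj.prodMk ?_)
    exact (hΓ.continuousOn_forward hv hT).comp_continuous (hproj.prodMk continuous_snd)
      (fun p => ⟨(projIcc 0 T hT p.1).2, mem_univ _⟩)
  have hPF : ∀ t ∈ Icc 0 T, ∀ y, P t y = F (t, Γ 0 y t) := fun t ht y => by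
    simp only [P, projIcc_of_mem hT ht]
  have e1 : ∫ t in Ioo 0 T, ∫ x, (deriv (fun s => φ (s, x)) t
      + fderiv ℝ (fun y => φ (t, y)) x (v t x)) ∂(ρ t) = ∫ t in Ioo 0 T, ∫ y, P t y ∂ρ₀ := by
    refine setIntegral_congr_fun measurableSet_Ioo fun t ht => ?_
    have ht' := Ioo_subset_Icc_self ht
    have e2 : ∀ x, deriv (fun s => φ (s, x)) t + fderiv ℝ (fun y => φ (t, y)) x (v t x)
        = F (t, x) := fun x =>
      deriv_add_fderiv_eq (hφ.differentiable (by simp) (t, x)) (v t x)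
    simp only [e2, hPF t ht']
    rw [hρ t ht', integral_map (hΓ.lipschitzWith_apply hv h0 ht').continuous.aemeasurable
      (by fun_prop)]
  rw [e1, integral_integral_swap]
  · refine integral_eq_zero_of_ae (Eventually.of_forall fun y => ?_)
    simp only [Pi.zero_apply]
    have e3 : ∫ t in Ioo 0 T, P t y = ∫ t in (0 : ℝ)..T, F (t, Γ 0 y t) := by
      rw [intervalIntegral.integral_of_le hT, integral_Ioc_eq_integral_Ioo]
      exact setIntegral_congr_fun measurableSet_Ioo
        fun t ht => hPF t (Ioo_subset_Icc_self ht) y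
    have hd : ∀ t ∈ uIcc 0 T, HasDerivAt (fun t => φ (t, Γ 0 y t)) (F (t, Γ 0 y t)) t := by
      intro t ht
      rw [uIcc_of_le hT] at ht
      exact (hφ.differentiable (by simp) _).hasFDerivAt.comp_hasDerivAt
        (f := fun t => (t, Γ 0 y t)) t
        ((hasDerivAt_id t).prodMk (hΓ.isTrajectory 0 h0 y t ht))
    have hFi : IntervalIntegrable (fun t => F (t, Γ 0 y t)) volume 0 T := by
      refine ContinuousOn.intervalIntegrable ?_
      rw [uIcc_of_le hT]
      exact hFc.comp_continuousOn
        (continuousOn_id.prodMk (hΓ.isTrajectory 0 h0 y).continuousOn)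
    rw [e3, intervalIntegral.integral_eq_sub_of_hasDerivAt hd hFi,
      image_eq_zero_of_notMem_tsupport (fun h => lt_irrefl _ (hφT h).1.2),
      image_eq_zero_of_notMem_tsupport (fun h => lt_irrefl _ (hφT h).1.1), sub_zero]
  · exact Integrable.of_bound hP.aestronglyMeasurable M (Eventually.of_forall fun p => hM _)

variable {B κ : ℝ} {L : ℝ≥0} {W : Space d → ℝ} {ρ₀ : Measure (Space d)}

/-- The linear growth weight `1 + |x|`. -/
noncomputable def growth (x : Space d) : ℝ := 1 + ‖x‖

theorem growth_pos (x : Space d) : 0 < growth x := by unfold growth; positivity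

theorem one_le_growth (x : Space d) : 1 ≤ growth x := by
  unfold growth
  linarith [norm_nonneg x]

theorem continuous_growth : Continuous (growth : Space d → ℝ) := by unfold growth; fun_prop

theorem MemP2.integrable_growth (h : MemP2 ρ₀) : Integrable growth ρ₀ := by
  have := h.1
  exact (integrable_const 1).add h.integrable_norm

theorem MemP2.integrable_growth_sq (h : MemP2 ρ₀) : Integrable (fun x => growth x ^ 2) ρ₀ := by
  have := h.1
  have e : (fun x : Space d => growth x ^ 2) = fun x => 1 + 2 * ‖x‖ + ‖x‖ ^ 2 := by
    funext x
    unfold growth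
    ring
  rw [e]
  exact ((integrable_const 1).add (h.integrable_norm.const_mul 2)).add h.integrable_norm_sq

theorem MemP2.lintegral_growth_sq_lt_top (h : MemP2 ρ₀) :
    ∫⁻ x, ‖growth x‖ₑ ^ 2 ∂ρ₀ < ⊤ := by
  have := h.integrable_growth_sq.2
  rw [hasFiniteIntegral_iff_enorm] at this
  simpa [enorm_pow] using this

/-- The drift of the mean field equation in the unknown `Z = X / (1 + |x|)`. -/
noncomputable def meanFieldDrift (κ : ℝ) (K : Space d → Space d) (ρ₀ : Measure (Space d))
    (Z : Space d → Space d) (x : Space d) : Space d :=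
  (growth x)⁻¹ • -(κ • ∫ y, K (growth x • Z x - growth y • Z y) ∂ρ₀)

theorem continuous_integral_kernel_sub {K : Space d → Space d} (hB : ∀ x, ‖K x‖ ≤ B)
    (hL : LipschitzWith L K) [IsProbabilityMeasure ρ₀] {X : Space d → Space d}
    (hX : Continuous X) : Continuous fun x => ∫ y, K (X x - X y) ∂ρ₀ := by
  have := Measure.isProbabilityMeasure_map (μ := ρ₀) hX.aemeasurable
  refine ((lipschitzWith_integral_kernel hB hL (ρ₀.map X)).continuous.comp hX).congr fun x => ?_
  exact integral_map hX.aemeasurable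
    (hL.continuous.comp (by fun_prop)).aestronglyMeasurable

theorem norm_meanFieldDrift_le {K : Space d → Space d} (hκ : 0 < κ) (hB : ∀ x, ‖K x‖ ≤ B)
    [IsProbabilityMeasure ρ₀] (Z : Space d → Space d) (x : Space d) :
    ‖meanFieldDrift κ K ρ₀ Z x‖ ≤ κ * B := by
  have hB0 : 0 ≤ B := (norm_nonneg _).trans (hB 0)
  rw [meanFieldDrift, norm_smul, norm_neg, norm_smul, Real.norm_of_nonneg hκ.le,
    Real.norm_of_nonneg (inv_nonneg.2 (growth_pos x).le)]
  have h1 : (growth x)⁻¹ ≤ 1 := inv_le_one_of_one_le₀ (one_le_growth x)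
  have h2 : ‖∫ y, K (growth x • Z x - growth y • Z y) ∂ρ₀‖ ≤ B :=
    (norm_integral_le_of_norm_le_const (Eventually.of_forall fun y => hB _)).trans (by simp)
  calc _ ≤ 1 * (κ * B) := by gcongr
    _ = _ := one_mul _

/-- In the unknown `Z = X / (1 + |x|)` the mean field drift is Lipschitz for the sup norm. -/
theorem norm_meanFieldDrift_sub_le {K : Space d → Space d} (hκ : 0 < κ) (hB : ∀ x, ‖K x‖ ≤ B)
    (hL : LipschitzWith L K) (hρ₀ : MemP2 ρ₀) (Z Z' : Space d →ᵇ Space d) (x : Space d) :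
    ‖meanFieldDrift κ K ρ₀ Z x - meanFieldDrift κ K ρ₀ Z' x‖
      ≤ κ * L * (1 + ∫ y, growth y ∂ρ₀) * dist Z Z' := by
  have := hρ₀.1
  have hcont : ∀ Z : Space d →ᵇ Space d, Continuous fun y => K (growth x • Z x - growth y • Z y) :=
    fun Z => hL.continuous.comp (continuous_const.sub (continuous_growth.smul Z.continuous))
  have hint : ∀ Z : Space d →ᵇ Space d,
      Integrable (fun y => K (growth x • Z x - growth y • Z y)) ρ₀ := fun Z =>
    Integrable.of_bound (hcont Z).aestronglyMeasurable B (Eventually.of_forall fun y => hB _)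
  have hdist : ∀ y, ‖Z y - Z' y‖ ≤ dist Z Z' := fun y => by
    rw [← dist_eq_norm]
    exact BoundedContinuousFunction.dist_coe_le_dist y
  have hm : 0 ≤ ∫ y, growth y ∂ρ₀ := integral_nonneg fun y => (growth_pos y).le
  have h1 : ‖∫ y, K (growth x • Z x - growth y • Z y) ∂ρ₀
      - ∫ y, K (growth x • Z' x - growth y • Z' y) ∂ρ₀‖
      ≤ L * dist Z Z' * (growth x + ∫ y, growth y ∂ρ₀) := by
    rw [← integral_sub (hint Z) (hint Z')]
    refine (norm_integral_le_of_norm_le (((integrable_const (growth x)).add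
      hρ₀.integrable_growth).const_mul (L * dist Z Z')) (Eventually.of_forall fun y => ?_)).trans ?_
    · refine (hL.norm_sub_le _ _).trans ?_
      have e : growth x • Z x - growth y • Z y - (growth x • Z' x - growth y • Z' y)
          = growth x • (Z x - Z' x) - growth y • (Z y - Z' y) := by
        rw [smul_sub, smul_sub]
        abel
      rw [e, mul_assoc]
      gcongr
      refine (norm_sub_le _ _).trans ?_
      rw [norm_smul, norm_smul, Real.norm_of_nonneg (growth_pos x).le,
        Real.norm_of_nonneg (growth_pos y).le, Pi.add_apply, mul_add, mul_comm (dist Z Z'),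
        mul_comm (dist Z Z')]
      have := (growth_pos x).le
      have := (growth_pos y).le
      gcongr <;> exact hdist _
    · rw [integral_const_mul]
      simp only [Pi.add_apply]
      rw [integral_add (integrable_const _) hρ₀.integrable_growth]
      simp
  have h2 : (growth x)⁻¹ * (growth x + ∫ y, growth y ∂ρ₀) ≤ 1 + ∫ y, growth y ∂ρ₀ := by
    rw [mul_add, inv_mul_cancel₀ (growth_pos x).ne']
    have : (growth x)⁻¹ ≤ 1 := inv_le_one_of_one_le₀ (one_le_growth x)
    have := mul_le_mul_of_nonneg_right this hm
    linarith
  rw [meanFieldDrift, meanFieldDrift, ← smul_sub, neg_sub_neg, ← smul_sub, norm_smul, norm_smul,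
    Real.norm_of_nonneg hκ.le, Real.norm_of_nonneg (inv_nonneg.2 (growth_pos x).le), norm_sub_rev]
  have hinv : 0 ≤ (growth x)⁻¹ := inv_nonneg.2 (growth_pos x).le
  calc _ ≤ (growth x)⁻¹ * (κ * (L * dist Z Z' * (growth x + ∫ y, growth y ∂ρ₀))) := by gcongr
    _ = κ * (L * dist Z Z') * ((growth x)⁻¹ * (growth x + ∫ y, growth y ∂ρ₀)) := by ring
    _ ≤ κ * (L * dist Z Z') * (1 + ∫ y, growth y ∂ρ₀) := by gcongr
    _ = _ := by ring

/-- The mean field equation `X' = -κ (X + ∫ ∇W(X - X(y)) dρ₀(y))`, `X(0) = id`, has a solution.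
It is obtained as an ordinary differential equation for `Z = X / (1 + |x|)` in the Banach space of
bounded continuous maps. -/
theorem exists_meanField_flow (hκ : 0 < κ) (hT : 0 ≤ T) (hB : ∀ x, ‖contGrad W x‖ ≤ B)
    (hL : LipschitzWith L (contGrad W)) (hρ₀ : MemP2 ρ₀) :
    ∃ X : ℝ → Space d → Space d, (∀ x, X 0 x = x) ∧
      ContinuousP2 T (fun t => ρ₀.map (X t)) ∧
      ∀ x, IsTrajectory T (velocity κ W (fun t => ρ₀.map (X t))) (fun t => X t x) := by
  have := hρ₀.1
  have hκB : 0 ≤ κ * B := (norm_nonneg _).trans (norm_meanFieldDrift_le (ρ₀ := ρ₀) hκ hB 0 0)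
  have hm : 0 ≤ ∫ y, growth y ∂ρ₀ := integral_nonneg fun y => (growth_pos y).le
  have hgs : ∀ Z : Space d →ᵇ Space d, Continuous fun x => growth x • Z x :=
    fun Z => continuous_growth.smul Z.continuous
  let b : (Space d →ᵇ Space d) → (Space d →ᵇ Space d) := fun Z =>
    BoundedContinuousFunction.ofNormedAddCommGroup (meanFieldDrift κ (contGrad W) ρ₀ Z)
      ((continuous_growth.inv₀ fun x => (growth_pos x).ne').smul
        ((continuous_integral_kernel_sub hB hL (hgs Z)).const_smul κ).neg) (κ * B)
      (norm_meanFieldDrift_le hκ hB Z)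
  let Z₀ : Space d →ᵇ Space d :=
    BoundedContinuousFunction.ofNormedAddCommGroup (fun x => (growth x)⁻¹ • x)
      ((continuous_growth.inv₀ fun x => (growth_pos x).ne').smul continuous_id) 1 (fun x => by
        rw [norm_smul, Real.norm_of_nonneg (inv_nonneg.2 (growth_pos x).le),
          inv_mul_le_iff₀ (growth_pos x), mul_one]
        unfold growth
        linarith)
  let Λ : ℝ≥0 := ⟨κ * L * (1 + ∫ y, growth y ∂ρ₀), by positivity⟩
  obtain ⟨Z, hZ0, hZ⟩ := exists_isTrajectory (κ := κ) (B := κ * B) (C := Λ) (b := fun _ => b)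
    (fun _ Z => (BoundedContinuousFunction.norm_le hκB).2
      (norm_meanFieldDrift_le hκ hB Z))
    (fun _ => LipschitzWith.of_dist_le_mul fun Z Z' =>
      (BoundedContinuousFunction.dist_le (by positivity)).2 fun x => by
        rw [dist_eq_norm]
        exact norm_meanFieldDrift_sub_le hκ hB hL hρ₀ Z Z' x)
    (fun _ => continuous_const) (show (0 : ℝ) ∈ Icc 0 T from ⟨le_rfl, hT⟩) Z₀
  let X : ℝ → Space d → Space d := fun t x => growth x • Z t x
  have hXc : ∀ t, Continuous (X t) := fun t => hgs (Z t)
  refine ⟨X, fun x => ?_, ⟨fun t _ => ⟨?_, ?_⟩, fun t ht => ?_⟩, fun x t ht => ?_⟩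
  · simp only [X]
    rw [hZ0]
    change growth x • (growth x)⁻¹ • x = x
    rw [smul_smul, mul_inv_cancel₀ (growth_pos x).ne', one_smul]
  · exact Measure.isProbabilityMeasure_map (hXc t).aemeasurable
  · rw [lintegral_map (by fun_prop) (hXc t).measurable]
    calc ∫⁻ y, ‖X t y‖ₑ ^ 2 ∂ρ₀ ≤ ∫⁻ y, ‖Z t‖ₑ ^ 2 * ‖growth y‖ₑ ^ 2 ∂ρ₀ := by
          refine lintegral_mono fun y => ?_
          rw [← mul_pow, mul_comm]
          simp only [X]
          rw [enorm_smul]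
          gcongr
          rw [enorm_le_iff_norm_le]
          exact (Z t).norm_coe_le_norm y
      _ = ‖Z t‖ₑ ^ 2 * ∫⁻ y, ‖growth y‖ₑ ^ 2 ∂ρ₀ :=
          lintegral_const_mul _ (by have := continuous_growth (d := d); fun_prop)
      _ < ⊤ := ENNReal.mul_lt_top (by simp) hρ₀.lintegral_growth_sq_lt_top
  · set A := ∫⁻ y, ‖growth y‖ₑ ^ 2 ∂ρ₀ with hA
    have hAtop : A ≠ ⊤ := hρ₀.lintegral_growth_sq_lt_top.ne
    have hbound : ∀ s, W2 (ρ₀.map (X s)) (ρ₀.map (X t)) ≤ (‖Z s - Z t‖ₑ ^ 2 * A) ^ (1 / 2 : ℝ) := by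
      intro s
      have hpair : Measurable fun y => (X s y, X t y) :=
        (hXc s).measurable.prodMk (hXc t).measurable
      have hfst : (ρ₀.map fun y => (X s y, X t y)).map Prod.fst = ρ₀.map (X s) := by
        rw [Measure.map_map measurable_fst hpair]
        rfl
      have hsnd : (ρ₀.map fun y => (X s y, X t y)).map Prod.snd = ρ₀.map (X t) := by
        rw [Measure.map_map measurable_snd hpair]
        rfl
      refine (iInf_le _ ⟨ρ₀.map fun y => (X s y, X t y), hfst, hsnd⟩).trans ?_
      have hcost : ∫⁻ p, ‖p.1 - p.2‖ₑ ^ 2 ∂(ρ₀.map fun y => (X s y, X t y))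
          ≤ ‖Z s - Z t‖ₑ ^ 2 * A := by
        rw [lintegral_map (by fun_prop) hpair, hA,
          ← lintegral_const_mul _ (by have := continuous_growth (d := d); fun_prop)]
        refine lintegral_mono fun y => ?_
        simp only [X]
        rw [← smul_sub, enorm_smul, ← mul_pow, mul_comm]
        gcongr
        rw [enorm_le_iff_norm_le]
        exact (Z s - Z t).norm_coe_le_norm y
      exact ENNReal.rpow_le_rpow hcost (by norm_num)
    have hlim : Tendsto (fun s => (‖Z s - Z t‖ₑ ^ 2 * A) ^ (1 / 2 : ℝ)) (𝓝[Icc 0 T] t) (𝓝 0) := by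
      have h1 : Tendsto (fun s => ‖Z s - Z t‖ₑ) (𝓝[Icc 0 T] t) (𝓝 0) := by
        have h2 : Tendsto (fun s => ‖Z s - Z t‖) (𝓝[Icc 0 T] t) (𝓝 0) :=
          tendsto_iff_norm_sub_tendsto_zero.1 (hZ.continuousOn t ht)
        have h3 := ENNReal.tendsto_ofReal h2
        simpa only [ofReal_norm, ENNReal.ofReal_zero] using h3
      have h4 : Tendsto (fun s => ‖Z s - Z t‖ₑ ^ 2 * A) (𝓝[Icc 0 T] t) (𝓝 0) := by
        have := ENNReal.Tendsto.mul_const (ENNReal.Tendsto.pow (n := 2) h1) (Or.inr hAtop)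
        simpa using this
      have := h4.ennrpow_const (1 / 2 : ℝ)
      simpa using this
    exact tendsto_of_tendsto_of_tendsto_of_le_of_le tendsto_const_nhds hlim
      (fun _ => bot_le) hbound
  · have h1 : HasDerivAt (fun t => Z t x) (-(κ • Z t x) + b (Z t) x) t := by
      have := (BoundedContinuousFunction.evalCLM ℝ (β := Space d) x).hasFDerivAt (x := Z t)
      exact this.comp_hasDerivAt t (hZ t ht)
    refine (h1.const_smul (growth x)).congr_deriv ?_
    rw [velocity_eq, smul_add, smul_neg, smul_comm]
    congr 1
    change growth x • (growth x)⁻¹ • -(κ • ∫ y, contGrad W (X t x - X t y) ∂ρ₀) = _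
    rw [smul_smul, mul_inv_cancel₀ (growth_pos x).ne', one_smul,
      integral_map (f := fun y => contGrad W (X t x - y)) (hXc t).aemeasurable
      (hL.continuous.comp (by fun_prop)).aestronglyMeasurable]

theorem exists_isWeakSolution (hκ : 0 < κ) (hT : 0 ≤ T) (hB : ∀ x, ‖contGrad W x‖ ≤ B)
    (hL : LipschitzWith L (contGrad W)) (hρ₀ : MemP2 ρ₀) :
    ∃ ρ, IsWeakSolution κ T W ρ₀ ρ := by
  have := hρ₀.1
  obtain ⟨X, hX0, hP2, hX⟩ := exists_meanField_flow hκ hT hB hL hρ₀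
  have h0 : (0 : ℝ) ∈ Icc 0 T := ⟨le_rfl, hT⟩
  obtain ⟨Γ, hΓ⟩ := exists_isFlow_extVelocity hκ hT hP2 hB hL
  have hlip := lipschitzWith_extVelocity hκ hT hP2 hB hL
  have hXΓ : ∀ t ∈ Icc 0 T, X t = fun y => Γ 0 y t := by
    intro t ht
    funext y
    have hXt : IsTrajectory T (extVelocity κ T hT W fun t => ρ₀.map (X t)) (fun t => X t y) := by
      intro s hs
      rw [extVelocity_of_mem hT hs]
      exact hX y s hs
    exact hXt.eq_of_eq hlip (hΓ.isTrajectory 0 h0 y) h0 ht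
      (by simp only [hX0, hΓ.apply_self 0 h0])
  refine ⟨fun t => ρ₀.map (X t), hP2, ?_, ?_⟩
  · have h := continuityEq_of_eq_map_flow hT hΓ hlip
      (uniformContinuous_extVelocity hκ hT hP2 hB hL).continuous
      (ρ := fun t => ρ₀.map (X t)) (ρ₀ := ρ₀) (fun t ht => by simp only [hXΓ t ht])
    intro φ h1 h2 h3
    refine Eq.trans ?_ (h φ h1 h2 h3)
    refine setIntegral_congr_fun measurableSet_Ioo fun t ht => ?_
    simp only [extVelocity_of_mem hT (Ioo_subset_Icc_self ht)]
  · have : X 0 = id := funext hX0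
    simp only [this, Measure.map_id]

end Existence

/-! ### Uniqueness -/

section Uniqueness

open scoped NNReal

variable {d : ℕ} {κ T B : ℝ} {L : ℝ≥0} {W : Space d → ℝ} {ρ₀ : Measure (Space d)}
  {X₁ X₂ : ℝ → Space d → Space d}

/-- Along two solutions of the mean field equation, the difference of the velocities is controlled
by the difference of the positions. -/
theorem norm_velocity_sub_velocity_le (hκ : 0 < κ) (hB : ∀ x, ‖contGrad W x‖ ≤ B)
    (hL : LipschitzWith L (contGrad W)) [IsProbabilityMeasure ρ₀] {t : ℝ}
    (h₁ : Continuous (X₁ t)) (h₂ : Continuous (X₂ t)) {r : ℝ} (hr : ∀ z, ‖X₁ t z - X₂ t z‖ ≤ r)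
    (y : Space d) :
    ‖velocity κ W (fun t => ρ₀.map (X₁ t)) t (X₁ t y)
      - velocity κ W (fun t => ρ₀.map (X₂ t)) t (X₂ t y)‖ ≤ κ * (1 + 2 * L) * r := by
  have hc : ∀ x : Space d, Continuous fun z => contGrad W (x - z) := fun x =>
    hL.continuous.comp (by fun_prop)
  have hi : ∀ (X : Space d → Space d), Continuous X →
      Integrable (fun z => contGrad W (X y - X z)) ρ₀ := fun X hX =>
    Integrable.of_bound ((hc _).comp hX).aestronglyMeasurable B (Eventually.of_forall fun z => hB _)
  have hK : ‖∫ z, contGrad W (X₁ t y - X₁ t z) ∂ρ₀ - ∫ z, contGrad W (X₂ t y - X₂ t z) ∂ρ₀‖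
      ≤ L * (r + r) := by
    rw [← integral_sub (hi _ h₁) (hi _ h₂)]
    refine (norm_integral_le_of_norm_le_const (C := L * (r + r))
      (Eventually.of_forall fun z => ?_)).trans (by simp)
    refine (hL.norm_sub_le _ _).trans ?_
    gcongr
    rw [sub_sub_sub_comm]
    exact (norm_sub_le _ _).trans (add_le_add (hr y) (hr z))
  rw [velocity_eq, velocity_eq, integral_map h₁.aemeasurable (hc _).aestronglyMeasurable,
    integral_map h₂.aemeasurable (hc _).aestronglyMeasurable, add_sub_add_comm, neg_sub_neg,
    neg_sub_neg, ← smul_sub, ← smul_sub, ← smul_add, norm_smul, Real.norm_of_nonneg hκ.le,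
    mul_assoc]
  gcongr
  rw [norm_sub_rev] at hK
  have h3 := hr y
  rw [norm_sub_rev] at h3
  refine (norm_add_le _ _).trans ((add_le_add h3 hK).trans (le_of_eq ?_))
  ring

/-- The mean field equation has at most one solution: with `c = κ (1 + 2 L)`, a bound
`S exp (2 c t)` on the difference of two solutions improves to `(S / 2) exp (2 c t)`. -/
theorem meanField_flow_unique (hκ : 0 < κ) (hB : ∀ x, ‖contGrad W x‖ ≤ B)
    (hL : LipschitzWith L (contGrad W)) [IsProbabilityMeasure ρ₀]
    (hc₁ : ∀ t ∈ Icc 0 T, Continuous (X₁ t)) (hc₂ : ∀ t ∈ Icc 0 T, Continuous (X₂ t))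
    (h₁ : ∀ y, IsTrajectory T (velocity κ W (fun t => ρ₀.map (X₁ t))) (fun t => X₁ t y))
    (h₂ : ∀ y, IsTrajectory T (velocity κ W (fun t => ρ₀.map (X₂ t))) (fun t => X₂ t y))
    (h0 : ∀ y, X₁ 0 y = X₂ 0 y) : ∀ t ∈ Icc 0 T, ∀ y, X₁ t y = X₂ t y := by
  have hB0 : 0 ≤ B := (norm_nonneg _).trans (hB 0)
  set c : ℝ := κ * (1 + 2 * L) with hcdef
  have hc : 0 < c := by positivity
  have hd : ∀ y, ∀ t ∈ Icc 0 T, HasDerivAt (fun t => X₁ t y - X₂ t y)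
      (velocity κ W (fun t => ρ₀.map (X₁ t)) t (X₁ t y)
        - velocity κ W (fun t => ρ₀.map (X₂ t)) t (X₂ t y)) t := fun y t ht =>
    (h₁ y t ht).sub (h₂ y t ht)
  -- the difference of two solutions is bounded because the kernel is
  have hbdd : ∃ S : ℝ, 0 ≤ S ∧ ∀ t ∈ Icc 0 T, ∀ y, ‖X₁ t y - X₂ t y‖ ≤ S := by
    refine ⟨2 * κ * B * |T| * Real.exp (κ * |T|), by positivity, fun t ht y => ?_⟩
    have := norm_le_gronwallBound_of_norm_deriv_right_le (K := κ) (ε := 2 * κ * B) (δ := 0)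
      (a := 0) (b := T)
      (fun s hs => (hd y s hs).continuousAt.continuousWithinAt)
      (fun s hs => (hd y s (Ico_subset_Icc_self hs)).hasDerivWithinAt) (by simp [h0])
      (fun s hs => by
        have hs' := Ico_subset_Icc_self hs
        have := Measure.isProbabilityMeasure_map (μ := ρ₀) (hc₁ s hs').aemeasurable
        have := Measure.isProbabilityMeasure_map (μ := ρ₀) (hc₂ s hs').aemeasurable
        rw [velocity_eq, velocity_eq, add_sub_add_comm, neg_sub_neg, neg_sub_neg, ← smul_sub,
          ← smul_sub]
        refine (norm_add_le _ _).trans ?_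
        rw [norm_smul, norm_smul, Real.norm_of_nonneg hκ.le, norm_sub_rev]
        have e : κ * ‖X₁ s y - X₂ s y‖ + 2 * κ * B = κ * ‖X₁ s y - X₂ s y‖ + κ * (B + B) := by ring
        rw [e]
        gcongr
        exact (norm_sub_le _ _).trans (add_le_add (norm_integral_kernel_le hB _ _)
          (norm_integral_kernel_le hB _ _))) t ht
    rw [sub_zero] at this
    refine this.trans ((gronwallBound_zero_le hκ.le (by positivity)).trans ?_)
    have : t ≤ |T| := ht.2.trans (le_abs_self T)
    have := ht.1
    gcongr
  obtain ⟨S, hS, hbd⟩ := hbdd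
  have hiter : ∀ n : ℕ, ∀ t ∈ Icc 0 T, ∀ y,
      ‖X₁ t y - X₂ t y‖ ≤ S / 2 ^ n * Real.exp (2 * c * t) := by
    intro n
    induction n with
    | zero =>
      intro t ht y
      have h1 : 1 ≤ Real.exp (2 * c * t) :=
        Real.one_le_exp (mul_nonneg (by positivity) ht.1)
      rw [pow_zero, div_one]
      exact (hbd t ht y).trans (le_mul_of_one_le_right hS h1)
    | succ n ih =>
      intro t ht y
      refine image_norm_le_of_norm_deriv_right_le_deriv_boundary
        (f := fun t => X₁ t y - X₂ t y) (a := 0) (b := T)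
        (B := fun t => S / 2 ^ (n + 1) * Real.exp (2 * c * t))
        (B' := fun t => c * (S / 2 ^ n * Real.exp (2 * c * t)))
        (fun s hs => (hd y s hs).continuousAt.continuousWithinAt)
        (fun s hs => (hd y s (Ico_subset_Icc_self hs)).hasDerivWithinAt)
        (by
          simp only [h0, sub_self, norm_zero]
          positivity) (fun s => ?_) (fun s hs => ?_) ht
      · have h1 : HasDerivAt (fun s => Real.exp (2 * c * s)) (Real.exp (2 * c * s) * (2 * c)) s := by
          simpa using ((hasDerivAt_id s).const_mul (2 * c)).exp
        refine (h1.const_mul (S / 2 ^ (n + 1))).congr_deriv ?_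
        rw [pow_succ]
        field_simp
      · have hs' := Ico_subset_Icc_self hs
        exact norm_velocity_sub_velocity_le hκ hB hL (hc₁ s hs') (hc₂ s hs') (ih s hs') y
  intro t ht y
  have hlim : Tendsto (fun n : ℕ => S / 2 ^ n * Real.exp (2 * c * t)) atTop (𝓝 0) := by
    have := (tendsto_const_nhds (x := S)).div_atTop
      (tendsto_pow_atTop_atTop_of_one_lt (one_lt_two : (1 : ℝ) < 2))
    simpa using this.mul_const (Real.exp (2 * c * t))
  have := ge_of_tendsto' hlim fun n => hiter n t ht y
  exact sub_eq_zero.1 (norm_le_zero_iff.1 this)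

/-- Only the values of the curve at time `t` enter the velocity at time `t`. -/
theorem velocity_congr {ρ ρ' : ℝ → Measure (Space d)} {t : ℝ} (h : ρ t = ρ' t) (x : Space d) :
    velocity κ W ρ t x = velocity κ W ρ' t x := by
  rw [velocity, velocity, h]

theorem IsWeakSolution.unique (hκ : 0 < κ) (hT : 0 ≤ T) (hB : ∀ x, ‖contGrad W x‖ ≤ B)
    (hL : LipschitzWith L (contGrad W)) (hρ₀ : MemP2 ρ₀) {ρ₁ ρ₂ : ℝ → Measure (Space d)}
    (h₁ : IsWeakSolution κ T W ρ₀ ρ₁) (h₂ : IsWeakSolution κ T W ρ₀ ρ₂) :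
    ∀ t ∈ Icc 0 T, ρ₁ t = ρ₂ t := by
  have := hρ₀.1
  have h0 : (0 : ℝ) ∈ Icc 0 T := ⟨le_rfl, hT⟩
  -- the flow of the velocity of a weak solution solves the mean field equation
  have key : ∀ ρ, IsWeakSolution κ T W ρ₀ ρ → ∃ X : ℝ → Space d → Space d,
      (∀ t ∈ Icc 0 T, ρ t = ρ₀.map (X t)) ∧ (∀ t ∈ Icc 0 T, Continuous (X t)) ∧
      (∀ y, IsTrajectory T (velocity κ W (fun t => ρ₀.map (X t))) (fun t => X t y)) ∧
      ∀ y, X 0 y = y := by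
    intro ρ h
    obtain ⟨Γ, hΓ⟩ := exists_isFlow_extVelocity hκ hT h.continuousP2 hB hL
    have hmap := fun t ht => h.eq_map_flow hκ hT hB hL hΓ (t := t) ht
    refine ⟨fun t y => Γ 0 y t, hmap, fun t ht => (hΓ.lipschitzWith_apply
      (lipschitzWith_extVelocity hκ hT h.continuousP2 hB hL) h0 ht).continuous, fun y t ht => ?_,
      hΓ.apply_self 0 h0⟩
    rw [← velocity_congr (ρ := ρ) (hmap t ht), ← extVelocity_of_mem hT ht]
    exact hΓ.isTrajectory 0 h0 y t ht
  obtain ⟨X₁, hm₁, hc₁, ht₁, hi₁⟩ := key ρ₁ h₁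
  obtain ⟨X₂, hm₂, hc₂, ht₂, hi₂⟩ := key ρ₂ h₂
  intro t ht
  have := meanField_flow_unique hκ hB hL hc₁ hc₂ ht₁ ht₂ (fun y => by rw [hi₁, hi₂]) t ht
  rw [hm₁ t ht, hm₂ t ht, funext this]

end Uniqueness

/-! ### The acceleration -/

section Acceleration

open scoped NNReal

variable {d : ℕ} {κ T B : ℝ} {L : ℝ≥0} {W : Space d → ℝ} {ρ₀ : Measure (Space d)}
  {ρ : ℝ → Measure (Space d)} {Γ : ℝ → Space d → ℝ → Space d}

/-- Along the flow of a weak solution the velocity grows at most linearly with the initial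
position. -/
theorem exists_norm_extVelocity_flow_le (hκ : 0 < κ) (hT : 0 ≤ T) (hρ : ContinuousP2 T ρ)
    (hB : ∀ x, ‖contGrad W x‖ ≤ B) (hL : LipschitzWith L (contGrad W))
    (hΓ : IsFlow T (extVelocity κ T hT W ρ) Γ) :
    ∃ A : ℝ≥0, ∀ t ∈ Icc 0 T, ∀ y, ‖extVelocity κ T hT W ρ t (Γ 0 y t)‖ ≤ A * growth y := by
  have h0 : (0 : ℝ) ∈ Icc 0 T := ⟨le_rfl, hT⟩
  have hB0 : 0 ≤ B := (norm_nonneg _).trans (hB 0)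
  have hlip := lipschitzWith_extVelocity hκ hT hρ hB hL
  obtain ⟨q, hq⟩ := isCompact_Icc.exists_bound_of_continuousOn
    (hΓ.isTrajectory 0 h0 0).continuousOn
  have hq0 : 0 ≤ q := (norm_nonneg _).trans (hq 0 h0)
  set C : ℝ≥0 := ⟨κ, hκ.le⟩ * (1 + L) with hC
  refine ⟨⟨κ * (q + Real.exp (C * T)) + κ * B, by positivity⟩, fun t ht y => ?_⟩
  have := (hρ.1 t ht).1
  have h1 := hΓ.dist_apply_le hlip h0 ht y 0
  rw [dist_zero_right, dist_eq_norm] at h1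
  have h2 : ‖Γ 0 y t‖ ≤ (q + Real.exp (C * T)) * growth y := by
    have h3 : ‖Γ 0 y t‖ ≤ ‖Γ 0 y t - Γ 0 0 t‖ + ‖Γ 0 0 t‖ := by
      simpa using norm_add_le (Γ 0 y t - Γ 0 0 t) (Γ 0 0 t)
    have h4 := hq t ht
    have h5 := mul_nonneg hq0 (norm_nonneg y)
    have h6 := Real.exp_pos (C * T)
    unfold growth
    nlinarith
  rw [extVelocity_of_mem hT ht, velocity_eq]
  refine (norm_add_le _ _).trans ?_
  rw [norm_neg, norm_neg, norm_smul, norm_smul, Real.norm_of_nonneg hκ.le]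
  have h7 := norm_integral_kernel_le hB (ρ t) (Γ 0 y t)
  have h8 : κ * B ≤ κ * B * growth y := le_mul_of_one_le_right (by positivity) (one_le_growth y)
  calc _ ≤ κ * ((q + Real.exp (C * T)) * growth y) + κ * B := by gcongr
    _ ≤ κ * ((q + Real.exp (C * T)) * growth y) + κ * B * growth y := by linarith
    _ = (κ * (q + Real.exp (C * T)) + κ * B) * growth y := by ring

theorem lipschitzWith_flow_projIcc (hT : 0 ≤ T) {v : ℝ → Space d → Space d} (hΓ : IsFlow T v Γ)
    {A : ℝ≥0} (hA : ∀ t ∈ Icc 0 T, ∀ y, ‖v t (Γ 0 y t)‖ ≤ A * growth y) (y : Space d) :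
    LipschitzWith (A * ⟨growth y, (growth_pos y).le⟩)
      (fun t => Γ 0 y (projIcc 0 T hT t : Icc (0 : ℝ) T)) := by
  have h0 : (0 : ℝ) ∈ Icc 0 T := ⟨le_rfl, hT⟩
  refine LipschitzWith.of_dist_le_mul fun s t => ?_
  have h1 := (convex_Icc (0 : ℝ) T).norm_image_sub_le_of_norm_hasDerivWithin_le
    (f := Γ 0 y) (f' := fun t => v t (Γ 0 y t)) (C := A * growth y)
    (fun r hr => (hΓ.isTrajectory 0 h0 y r hr).hasDerivWithinAt) (fun r hr => hA r hr y)
    (projIcc 0 T hT t).2 (projIcc 0 T hT s).2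
  rw [← dist_eq_norm, ← dist_eq_norm] at h1
  refine h1.trans ?_
  have h2 := (LipschitzWith.projIcc hT).dist_le_mul s t
  rw [NNReal.coe_one, one_mul] at h2
  exact mul_le_mul_of_nonneg_left h2 (mul_nonneg A.2 (growth_pos y).le)

/-- The velocity field of a weak solution is Lipschitz in time and space. -/
theorem exists_lipschitzWith_uncurry_extVelocity (hκ : 0 < κ) (hT : 0 ≤ T) (hρ₀ : MemP2 ρ₀)
    (hB : ∀ x, ‖contGrad W x‖ ≤ B) (hL : LipschitzWith L (contGrad W))
    (h : IsWeakSolution κ T W ρ₀ ρ) (hΓ : IsFlow T (extVelocity κ T hT W ρ) Γ) {A : ℝ≥0}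
    (hA : ∀ t ∈ Icc 0 T, ∀ y, ‖extVelocity κ T hT W ρ t (Γ 0 y t)‖ ≤ A * growth y) :
    ∃ M, LipschitzWith M (Function.uncurry (extVelocity κ T hT W ρ)) := by
  have := hρ₀.1
  have h0 : (0 : ℝ) ∈ Icc 0 T := ⟨le_rfl, hT⟩
  have hlip := lipschitzWith_extVelocity hκ hT h.continuousP2 hB hL
  set C : ℝ≥0 := ⟨κ, hκ.le⟩ * (1 + L) with hC
  have hm : 0 ≤ ∫ y, growth y ∂ρ₀ := integral_nonneg fun y => (growth_pos y).le
  let D : ℝ≥0 := ⟨κ * (L * (A * ∫ y, growth y ∂ρ₀)), by positivity⟩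
  have hc : ∀ x : Space d, Continuous fun z => contGrad W (x - z) := fun x =>
    hL.continuous.comp (by fun_prop)
  have hX : ∀ t : Icc (0 : ℝ) T, Continuous fun y => Γ 0 y t := fun t =>
    (hΓ.lipschitzWith_apply hlip h0 t.2).continuous
  have hi : ∀ (x : Space d) (t : Icc (0 : ℝ) T),
      Integrable (fun y => contGrad W (x - Γ 0 y t)) ρ₀ := fun x t =>
    Integrable.of_bound ((hc x).comp (hX t)).aestronglyMeasurable B
      (Eventually.of_forall fun y => hB _)
  have htime : ∀ x s t, dist (extVelocity κ T hT W ρ s x) (extVelocity κ T hT W ρ t x)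
      ≤ D * dist s t := by
    intro x s t
    have e : ∀ r, extVelocity κ T hT W ρ r x
        = -(κ • x) + -(κ • ∫ y, contGrad W (x - Γ 0 y (projIcc 0 T hT r : Icc (0 : ℝ) T)) ∂ρ₀) := by
      intro r
      rw [extVelocity, velocity_eq, h.eq_map_flow hκ hT hB hL hΓ (projIcc 0 T hT r).2,
        integral_map (hX _).aemeasurable (hc x).aestronglyMeasurable]
    rw [e, e, dist_add_left, dist_neg_neg, dist_smul₀, Real.norm_of_nonneg hκ.le]
    change _ ≤ κ * (L * (A * ∫ y, growth y ∂ρ₀)) * dist s t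
    rw [mul_assoc]
    refine mul_le_mul_of_nonneg_left ?_ hκ.le
    rw [dist_eq_norm, ← integral_sub (hi x _) (hi x _)]
    refine (norm_integral_le_of_norm_le (hρ₀.integrable_growth.const_mul (L * A * dist s t))
      (Eventually.of_forall fun y => ?_)).trans (le_of_eq ?_)
    · refine (hL.norm_sub_le _ _).trans ?_
      rw [sub_sub_sub_cancel_left, norm_sub_rev, ← dist_eq_norm, mul_assoc, mul_assoc]
      refine mul_le_mul_of_nonneg_left ?_ L.2
      refine ((lipschitzWith_flow_projIcc hT hΓ hA y).dist_le_mul s t).trans (le_of_eq ?_)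
      change A * growth y * dist s t = _
      ring
    · rw [integral_const_mul]
      ring
  refine ⟨D + C, LipschitzWith.of_dist_le_mul fun ⟨s, x⟩ ⟨t, y⟩ => ?_⟩
  have h1 : dist s t ≤ dist (s, x) (t, y) := le_max_left _ _
  have h2 : dist x y ≤ dist (s, x) (t, y) := le_max_right _ _
  calc dist (extVelocity κ T hT W ρ s x) (extVelocity κ T hT W ρ t y)
      ≤ dist (extVelocity κ T hT W ρ s x) (extVelocity κ T hT W ρ t x)
        + dist (extVelocity κ T hT W ρ t x) (extVelocity κ T hT W ρ t y) := dist_triangle _ _ _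
    _ ≤ D * dist (s, x) (t, y) + C * dist (s, x) (t, y) :=
      add_le_add ((htime x s t).trans (mul_le_mul_of_nonneg_left h1 D.2))
        (((hlip t).dist_le_mul x y).trans (mul_le_mul_of_nonneg_left h2 C.2))
    _ = ((D + C : ℝ≥0) : ℝ) * dist (s, x) (t, y) := by
      rw [NNReal.coe_add]
      ring

section LipschitzField

variable {V : ℝ × Space d → Space d} {M : ℝ≥0}

/-- The restriction of the field `V` to the space-time line through `p` with direction
`(1, V p)`. -/
def alongVelocity (V : ℝ × Space d → Space d) (p : ℝ × Space d) (s : ℝ) : Space d :=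
  V (p + s • (1, V p))

theorem continuous_alongVelocity (hV : Continuous V) :
    Continuous (Function.uncurry (alongVelocity V)) := by
  unfold alongVelocity Function.uncurry
  fun_prop

theorem measurableSet_differentiableAt_alongVelocity (hV : Continuous V) :
    MeasurableSet {p | DifferentiableAt ℝ (alongVelocity V p) 0} :=
  (measurableSet_of_differentiableAt_with_param ℝ (continuous_alongVelocity hV)).preimage
    (f := fun p : ℝ × Space d => (p, (0 : ℝ))) (by fun_prop)

theorem norm_deriv_alongVelocity_le (hV : LipschitzWith M V) (p : ℝ × Space d) :
    ‖deriv (alongVelocity V p) 0‖ ≤ M * (1 + ‖V p‖) := by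
  have h : LipschitzWith (M * ‖((1 : ℝ), V p)‖₊) (alongVelocity V p) := by
    refine LipschitzWith.of_dist_le_mul fun s t => ?_
    refine (hV.dist_le_mul _ _).trans (le_of_eq ?_)
    rw [dist_add_left, dist_eq_norm, ← sub_smul, norm_smul, dist_eq_norm]
    push_cast
    ring
  refine (norm_deriv_le_of_lipschitz h).trans ?_
  rw [NNReal.coe_mul, coe_nnnorm]
  gcongr
  rw [Prod.norm_def]
  simp only [norm_one]
  exact max_le (by linarith [norm_nonneg (V p)]) (by linarith)

/-- A Lipschitz field is differentiable along its space-time direction wherever it is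
differentiable along a trajectory: the trajectory and its tangent line differ by `o(s)`. -/
theorem differentiableAt_alongVelocity (hV : LipschitzWith M V) {α : ℝ → Space d} {t : ℝ}
    (hα : HasDerivAt α (V (t, α t)) t) (hd : DifferentiableAt ℝ (fun s => V (s, α s)) t) :
    DifferentiableAt ℝ (alongVelocity V (t, α t)) 0 := by
  have h1 : HasDerivAt (fun s => V (t + s, α (t + s))) (deriv (fun s => V (s, α s)) t) 0 := by
    have := hd.hasDerivAt
    rw [← add_zero t] at this
    simpa using this.comp_const_add t 0
  have h2 : HasDerivAt (fun s => alongVelocity V (t, α t) s - V (t + s, α (t + s))) 0 0 := by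
    have h3 : HasDerivAt (fun s => α (t + s) - α t - s • V (t, α t)) 0 0 := by
      have h4 : HasDerivAt (fun s => α (t + s)) (V (t, α t)) 0 := by
        have : HasDerivAt α (V (t, α t)) (t + 0) := by rwa [add_zero]
        exact this.comp_const_add t 0
      have h5 : HasDerivAt (fun s : ℝ => s • V (t, α t)) ((1 : ℝ) • V (t, α t)) 0 :=
        (hasDerivAt_id (0 : ℝ)).smul_const _
      refine ((h4.sub_const (α t)).sub h5).congr_deriv ?_
      rw [one_smul, sub_self]
    rw [hasDerivAt_iff_isLittleO] at h3 ⊢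
    refine Asymptotics.IsBigO.trans_isLittleO ?_ h3
    refine Asymptotics.IsBigO.of_bound M (Eventually.of_forall fun s => ?_)
    have e : ((t, α t) + s • (1, V (t, α t)) : ℝ × Space d) = (t + s, α t + s • V (t, α t)) := by
      ext <;> simp
    have h6 := hV.dist_le_mul (t + s, α t + s • V (t, α t)) (t + s, α (t + s))
    rw [dist_eq_norm, Prod.dist_eq, dist_self, max_eq_right dist_nonneg, dist_eq_norm] at h6
    have e0 : alongVelocity V (t, α t) 0 = V (t, α t) := by simp [alongVelocity]
    simp only [e0, add_zero, sub_self, zero_smul, sub_zero, smul_zero]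
    rw [alongVelocity, e]
    refine h6.trans (le_of_eq ?_)
    rw [norm_sub_rev, sub_add_eq_sub_sub]
  have := (h2.add h1).differentiableAt
  refine this.congr_of_eventuallyEq (Eventually.of_forall fun s => ?_)
  simp

end LipschitzField

/-- A Lipschitz map sends null sets to null sets. -/
theorem volume_image_eq_zero {K : ℝ≥0} {f : Space d → Space d} (hf : LipschitzWith K f)
    {s : Set (Space d)} (hs : volume s = 0) : volume (f '' s) = 0 := by
  have h1 : (Measure.hausdorffMeasure (d : ℝ) : Measure (Space d)) ≪ volume :=
    Measure.absolutelyContinuous_isAddHaarMeasure _ _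
  have h2 : (volume : Measure (Space d)) ≪ Measure.hausdorffMeasure (d : ℝ) :=
    Measure.absolutelyContinuous_isAddHaarMeasure _ _
  refine h2 (le_antisymm ((hf.hausdorffMeasure_image_le (Nat.cast_nonneg d) s).trans ?_) bot_le)
  rw [h1 hs, mul_zero]

/-- The flow of a Lipschitz field preserves absolute continuity, its inverse being Lipschitz. -/
theorem IsFlow.map_absolutelyContinuous {v : ℝ → Space d → Space d} {C : ℝ≥0}
    (hΓ : IsFlow T v Γ) (hv : ∀ t, LipschitzWith C (v t)) (hT : 0 ≤ T) (hac : ρ₀ ≪ volume) {t : ℝ}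
    (ht : t ∈ Icc 0 T) : ρ₀.map (fun y => Γ 0 y t) ≪ volume := by
  have h0 : (0 : ℝ) ∈ Icc 0 T := ⟨le_rfl, hT⟩
  refine Measure.AbsolutelyContinuous.mk fun s hs hs0 => ?_
  rw [Measure.map_apply (hΓ.lipschitzWith_apply hv h0 ht).continuous.measurable hs]
  refine hac (measure_mono_null (fun y hy => ?_)
    (volume_image_eq_zero (hΓ.lipschitzWith_apply hv ht h0) hs0))
  exact ⟨Γ 0 y t, hy, hΓ.apply_apply_self hv h0 ht y⟩

theorem IsWeakSolution.exists_acceleration (hκ : 0 < κ) (hT : 0 ≤ T)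
    (hB : ∀ x, ‖contGrad W x‖ ≤ B) (hL : LipschitzWith L (contGrad W)) (hρ₀ : MemP2 ρ₀)
    (h : IsWeakSolution κ T W ρ₀ ρ) :
    ∃ a : ℝ × Space d → Space d, IsAcceleration T ρ (velocity κ W ρ) a ∧
      (ρ₀ ≪ volume → IsClassicalAcceleration T ρ (velocity κ W ρ) a) ∧ SqrtRhoMulMemL2 T ρ a := by
  have := hρ₀.1
  have h0 : (0 : ℝ) ∈ Icc 0 T := ⟨le_rfl, hT⟩
  have hlip := lipschitzWith_extVelocity hκ hT h.continuousP2 hB hL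
  obtain ⟨Γ, hΓ⟩ := exists_isFlow_extVelocity hκ hT h.continuousP2 hB hL
  obtain ⟨A, hA⟩ := exists_norm_extVelocity_flow_le hκ hT h.continuousP2 hB hL hΓ
  obtain ⟨M, hM⟩ := exists_lipschitzWith_uncurry_extVelocity hκ hT hρ₀ hB hL h hΓ hA
  set V : ℝ × Space d → Space d := Function.uncurry (extVelocity κ T hT W ρ) with hVdef
  have hX : ∀ t ∈ Icc 0 T, Continuous fun y => Γ 0 y t := fun t ht =>
    (hΓ.lipschitzWith_apply hlip h0 ht).continuous
  have hmap : ∀ t ∈ Icc 0 T, ρ t = ρ₀.map fun y => Γ 0 y t := fun t ht =>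
    h.eq_map_flow hκ hT hB hL hΓ ht
  have hVu : ∀ t ∈ Ioo 0 T, ∀ x,
      (fun p : ℝ × Space d => velocity κ W ρ p.1 p.2) =ᶠ[𝓝 (t, x)] V := by
    intro t ht x
    filter_upwards [continuous_fst.continuousAt.preimage_mem_nhds
      (x := ((t, x) : ℝ × Space d)) (Icc_mem_nhds ht.1 ht.2)] with p hp
    exact (extVelocity_of_mem hT hp p.2).symm
  have hVt : ∀ t ∈ Ioo 0 T, ∀ x, V (t, x) = velocity κ W ρ t x := fun t ht x =>
    extVelocity_of_mem hT (Ioo_subset_Icc_self ht) x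
  let a : ℝ × Space d → Space d :=
    (Ioo 0 T ×ˢ univ).indicator fun p => deriv (alongVelocity V p) 0
  have ha : ∀ t ∈ Ioo 0 T, ∀ x, a (t, x) = deriv (alongVelocity V (t, x)) 0 := fun t ht x =>
    indicator_of_mem (show (t, x) ∈ Ioo 0 T ×ˢ univ from ⟨ht, mem_univ _⟩) _
  have ham : Measurable a := by
    refine Measurable.indicator ?_ (measurableSet_Ioo.prod MeasurableSet.univ)
    exact (measurable_deriv_with_param (continuous_alongVelocity hM.continuous)).comp
      (g := fun q : (ℝ × Space d) × ℝ => deriv (alongVelocity V q.1) q.2)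
      (f := fun p : ℝ × Space d => (p, (0 : ℝ))) (by fun_prop)
  -- along every trajectory the velocity is Lipschitz in time, hence differentiable a.e.
  have hdiff : ∀ᵐ t ∂(volume.restrict (Ioo 0 T)), ∀ᵐ x ∂(ρ t),
      DifferentiableAt ℝ (alongVelocity V (t, x)) 0 := by
    let g : Space d → ℝ → Space d := fun y s =>
      V (s, Γ 0 y (projIcc 0 T hT s : Icc (0 : ℝ) T))
    have hproj : Continuous fun p : Space d × ℝ => ((projIcc 0 T hT p.2 : Icc (0 : ℝ) T) : ℝ) :=
      continuous_subtype_val.comp (continuous_projIcc.comp continuous_snd)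
    have hgc : Continuous (Function.uncurry g) := by
      refine hM.continuous.comp (continuous_snd.prodMk ?_)
      exact (hΓ.continuousOn_forward hlip hT).comp_continuous (hproj.prodMk continuous_fst)
        (fun p => ⟨(projIcc 0 T hT p.2).2, mem_univ _⟩)
    have hgl : ∀ y, ∀ᵐ s, DifferentiableAt ℝ (g y) s := fun y =>
      (hM.comp (LipschitzWith.id.prodMk
        (lipschitzWith_flow_projIcc hT hΓ hA y))).ae_differentiableAt_real
    have hswap : ∀ᵐ s, ∀ᵐ y ∂ρ₀, DifferentiableAt ℝ (g y) s :=
      (Measure.ae_ae_comm (measurableSet_of_differentiableAt_with_param ℝ hgc)).1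
        (Eventually.of_forall hgl)
    filter_upwards [ae_restrict_of_ae hswap, ae_restrict_mem measurableSet_Ioo] with t ht htT
    have htI := Ioo_subset_Icc_self htT
    have hms : MeasurableSet {x | DifferentiableAt ℝ (alongVelocity V (t, x)) 0} :=
      (measurableSet_differentiableAt_alongVelocity hM.continuous).preimage
        (f := fun x : Space d => (t, x)) (by fun_prop)
    rw [hmap t htI, ae_map_iff (hX t htI).aemeasurable hms]
    filter_upwards [ht] with y hy
    refine differentiableAt_alongVelocity hM (α := Γ 0 y) (hΓ.isTrajectory 0 h0 y t htI) ?_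
    refine hy.congr_of_eventuallyEq ?_
    filter_upwards [Icc_mem_nhds htT.1 htT.2] with s hs
    simp only [g, projIcc_of_mem hT hs]
  refine ⟨a, ?_, fun hac => ?_, ham, ?_⟩
  · filter_upwards [hdiff, ae_restrict_mem measurableSet_Ioo] with t ht htT
    filter_upwards [ht] with x hx
    have h1 : HasLineDerivAt ℝ V (a (t, x)) (t, x) (1, velocity κ W ρ t x) := by
      rw [ha t htT, ← hVt t htT]
      exact hx.hasDerivAt
    exact h1.congr_of_eventuallyEq (hVu t htT x)
  · have hrad : ∀ᵐ t : ℝ, ∀ᵐ x : Space d, DifferentiableAt ℝ V (t, x) := by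
      have hHaar : ((volume : Measure ℝ).prod (volume : Measure (Space d))).IsAddHaarMeasure :=
        inferInstance
      exact Measure.ae_ae_of_ae_prod
        (hM.ae_differentiableAt (μ := (volume : Measure ℝ).prod (volume : Measure (Space d))))
    filter_upwards [ae_restrict_of_ae hrad, ae_restrict_mem measurableSet_Ioo] with t ht htT
    have htI := Ioo_subset_Icc_self htT
    have hact : ρ t ≪ volume := by
      rw [hmap t htI]
      exact hΓ.map_absolutelyContinuous hlip hT hac htI
    filter_upwards [hact.ae_le ht] with x hx
    have hd : DifferentiableAt ℝ (fun p : ℝ × Space d => velocity κ W ρ p.1 p.2) (t, x) :=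
      hx.congr_of_eventuallyEq (hVu t htT x)
    refine ⟨hd, ?_⟩
    have h1 := deriv_add_fderiv_eq hd (velocity κ W ρ t x)
    simp only at h1
    rw [ha t htT]
    refine Eq.trans ?_ h1.symm
    rw [(hVu t htT x).fderiv_eq, ← hVt t htT]
    exact (hx.hasFDerivAt.hasLineDerivAt (1, V (t, x))).deriv
  · have hbound : ∀ t ∈ Ioo 0 T, ∫⁻ x, ‖a (t, x)‖ₑ ^ 2 ∂(ρ t)
        ≤ ((M * (1 + A) : ℝ≥0) : ℝ≥0∞) ^ 2 * ∫⁻ y, ‖growth y‖ₑ ^ 2 ∂ρ₀ := by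
      intro t ht
      have htI := Ioo_subset_Icc_self ht
      rw [hmap t htI, lintegral_map (by fun_prop) (hX t htI).measurable,
        ← lintegral_const_mul _ (by have := continuous_growth (d := d); fun_prop)]
      refine lintegral_mono fun y => ?_
      rw [← mul_pow]
      gcongr
      have h1 : ‖a (t, Γ 0 y t)‖ ≤ (M * (1 + A) : ℝ≥0) * ‖growth y‖ := by
        rw [ha t ht, Real.norm_of_nonneg (growth_pos y).le]
        refine (norm_deriv_alongVelocity_le hM _).trans ?_
        have h2 : ‖V (t, Γ 0 y t)‖ ≤ A * growth y := hA t htI y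
        have h3 := one_le_growth y
        push_cast
        rw [mul_assoc]
        gcongr
        linarith
      rw [← ofReal_norm, ← ofReal_norm, ← ENNReal.ofReal_coe_nnreal,
        ← ENNReal.ofReal_mul (NNReal.coe_nonneg _)]
      exact ENNReal.ofReal_le_ofReal h1
    refine (setLIntegral_mono' measurableSet_Ioo hbound).trans_lt ?_
    rw [setLIntegral_const]
    refine ENNReal.mul_lt_top (ENNReal.mul_lt_top (by finiteness) hρ₀.lintegral_growth_sq_lt_top) ?_
    simp

end Acceleration

end Aggregation

theorem theorem4p1 {d : ℕ} (κ : ℝ) (hκ : 0 < κ) (T : ℝ) (hT : 0 < T)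
    (W : Aggregation.Space d → ℝ) (hWsymm : ∀ᵐ x, W (-x) = W x)
    (hW : Aggregation.GradMemW1Infty W)
    (ρ₀ : MeasureTheory.Measure (Aggregation.Space d)) (hρ₀ : Aggregation.MemP2 ρ₀) :
    (∃ ρ : ℝ → MeasureTheory.Measure (Aggregation.Space d),
      Aggregation.IsWeakSolution κ T W ρ₀ ρ) ∧
    (∀ ρ₁ ρ₂ : ℝ → MeasureTheory.Measure (Aggregation.Space d),
      Aggregation.IsWeakSolution κ T W ρ₀ ρ₁ → Aggregation.IsWeakSolution κ T W ρ₀ ρ₂ →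
        ∀ t ∈ Set.Icc 0 T, ρ₁ t = ρ₂ t) ∧
    (∀ ρ : ℝ → MeasureTheory.Measure (Aggregation.Space d),
      Aggregation.IsWeakSolution κ T W ρ₀ ρ →
        ∃ a : ℝ × Aggregation.Space d → Aggregation.Space d,
          Aggregation.IsAcceleration T ρ (Aggregation.velocity κ W ρ) a ∧
          (MeasureTheory.Measure.AbsolutelyContinuous ρ₀ MeasureTheory.volume →
            Aggregation.IsClassicalAcceleration T ρ (Aggregation.velocity κ W ρ) a) ∧
          Aggregation.SqrtRhoMulMemL2 T ρ a) := by
  obtain ⟨B, L, hB, hL⟩ := hW.contGrad_bounded_lipschitz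
  exact ⟨Aggregation.exists_isWeakSolution hκ hT.le hB hL hρ₀,
    fun _ _ h₁ h₂ => h₁.unique hκ hT.le hB hL hρ₀ h₂,
    fun _ h => h.exists_acceleration hκ hT.le hB hL hρ₀⟩
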